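/- **Definitions.** Let $a_1^{\pm1},a_2^{\pm1},\dots$ be a countably infinite set of letters with formal inverses. A *word* is a function $W:\overline{W}\to\{a_n^{\pm1}\}_{n\ge 1}$ on a countable totally ordered set $\overline W$ such that, for each $N$, only finitely many positions carry a letter from $\{a_1^{\pm1},\dots,a_N^{\pm1}\}$. Let $p_N(W)$ be the finite word obtained from $W$ by deleting all letters $a_n^{\pm1}$ with $n>N$, and write $W_1\sim W_2$ if $p_N(W_1)=p_N(W_2)$ in the free group $F(a_1,\dots,a_N)$ for every $N$. The Hawaiian earring group $\mathrm{HEG}$ is the set of words modulo $\sim$, under concatenation; $p_N$ induces a retraction homomorphism $p_N:\mathrm{HEG}\to\mathrm{HEG}$ onto the free subgroup on $a_1,\dots,a_N$. A group $G$ is - *n-slender* if for every homomorphism $\phi:\mathrm{HEG}\to G$ there is $N\in\mathbb N$ with $\phi=\phi\circ p_N$; - *cm-slender* if every homomorphism from a completely metrizable topological group to $G$ has open kernel; - *lcH-slender* if every homomorphism from a locally compact Hausdorff topological group to $G$ has open kernel. For a simple graph $\Gamma$ with (possibly infinite) vertex set $V$ and a family of groups $(G_v)_{v\in V}$, the *graph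 product* of the family over $\Gamma$ is the quotient of the free product $\ast_{v\in V}G_v$ by the normal subgroup generated by all commutators $[g,g']$ with $g\in G_v$, $g'\in G_{v'}$ and $v,v'$ adjacent in $\Gamma$. The *direct sum* $\bigoplus_{v\in V}G_v$ is the subgroup of $\prod_{v\in V}G_v$ of elements with finite support. **Theorem.** Let $\mathcal S$ be any one of the three classes of n-slender, cm-slender, or lcH-slender groups. Let $\Gamma$ be a simple graph with vertex set $V$ and let $(G_v)_{v\in V}$ be a family of groups, each belonging to $\mathcal S$. Then the graph product of $(G_v)_{v\in V}$ over $\Gamma$ belongs to $\mathcal S$. In particular, the free product $\ast_{v\in V}G_v$ and the direct sum $\bigoplus_{v\in V}G_v$ belong to $\mathcal S$. -/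

import Mathlib

universe u w x

/-! ### Words and the Hawaiian earring group -/

/-- A word in the letters `a₀^{±1}, a₁^{±1}, …`: a function from a countable totally ordered set to
the letters such that, for every `N`, only finitely many positions carry a letter among
`a₀^{±1}, …, a_{N-1}^{±1}`. The letter `(n, true)` is `aₙ` and `(n, false)` is `aₙ⁻¹`
(the convention of `FreeGroup.mk`). -/
structure EarringWord : Type 1 where
  Carrier : Type
  [order : LinearOrder Carrier]
  [countable : Countable Carrier]
  letter : Carrier → ℕ × Bool
  finite_lt : ∀ N : ℕ, {i : Carrier | (letter i).1 < N}.Finite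

namespace EarringWord

attribute [instance] EarringWord.order EarringWord.countable

/-- The positions of `W` carrying letters of index `< N`, listed in increasing order. -/
noncomputable def positions (W : EarringWord) (N : ℕ) : List W.Carrier :=
  (W.finite_lt N).toFinset.sort (· ≤ ·)

/-- The finite word `p_N(W)` obtained from `W` by keeping only the letters of index `< N`, as an
element of the free group (on all letters; it lies in the free subgroup on `a₀, …, a_{N-1}`). -/
noncomputable def toFree (N : ℕ) (W : EarringWord) : FreeGroup ℕ :=
  FreeGroup.mk ((W.positions N).map W.letter)

/-- `W₁ ∼ W₂` if `p_N(W₁) = p_N(W₂)` in the free group, for every `N`. -/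
instance setoid : Setoid EarringWord where
  r W₁ W₂ := ∀ N : ℕ, toFree N W₁ = toFree N W₂
  iseqv := ⟨fun _ _ => rfl, fun h N => (h N).symm, fun h k N => (h N).trans (k N)⟩

theorem equiv_def {W₁ W₂ : EarringWord} : W₁ ≈ W₂ ↔ ∀ N : ℕ, toFree N W₁ = toFree N W₂ :=
  Iff.rfl

/-- The empty word. -/
def empty : EarringWord where
  Carrier := Empty
  letter := Empty.elim
  finite_lt _ := Set.toFinite _

/-- Concatenation of words: every position of `W₁` comes before every position of `W₂`. -/
def concat (W₁ W₂ : EarringWord) : EarringWord where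
  Carrier := W₁.Carrier ⊕ₗ W₂.Carrier
  countable := inferInstanceAs (Countable (W₁.Carrier ⊕ W₂.Carrier))
  letter i := Sum.elim W₁.letter W₂.letter (ofLex i)
  finite_lt N := by
    refine (((W₁.finite_lt N).image fun i => toLex (Sum.inl i)).union
      ((W₂.finite_lt N).image fun i => toLex (Sum.inr i))).subset ?_
    intro i
    induction i using Lex.rec with | _ i
    rcases i with j | j
    · exact fun hi => Or.inl ⟨j, hi, rfl⟩
    · exact fun hi => Or.inr ⟨j, hi, rfl⟩

/-- The inverse word: reverse the order of the positions and invert each letter. -/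
def reverse (W : EarringWord) : EarringWord where
  Carrier := W.Carrierᵒᵈ
  countable := inferInstanceAs (Countable W.Carrier)
  letter i := ((W.letter (OrderDual.ofDual i)).1, !(W.letter (OrderDual.ofDual i)).2)
  finite_lt N := W.finite_lt N

/-- The word `p_N(W)`: the restriction of `W` to the positions carrying letters of index `< N`. -/
def truncate (N : ℕ) (W : EarringWord) : EarringWord where
  Carrier := {i : W.Carrier // (W.letter i).1 < N}
  letter i := W.letter i.1
  finite_lt M := (W.finite_lt M).preimage Subtype.val_injective.injOn

theorem mem_positions {W : EarringWord} {N : ℕ} {i : W.Carrier} :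
    i ∈ W.positions N ↔ (W.letter i).1 < N := by
  simp [positions]

theorem pairwise_positions (W : EarringWord) (N : ℕ) : (W.positions N).Pairwise (· < ·) :=
  Finset.sortedLT_sort _ |>.pairwise

theorem positions_eq {W : EarringWord} {N : ℕ} {l : List W.Carrier} (hl : l.Pairwise (· < ·))
    (hmem : ∀ i, i ∈ l ↔ (W.letter i).1 < N) : W.positions N = l := by
  refine List.Perm.eq_of_pairwise (le := (· < ·)) (fun a b _ _ h h' => absurd h' h.asymm)
    (W.pairwise_positions N) hl ?_
  refine (List.perm_ext_iff_of_nodup ((W.pairwise_positions N).imp ne_of_lt)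
    (hl.imp ne_of_lt)).2 fun i => ?_
  rw [mem_positions, hmem]

theorem toFree_empty (N : ℕ) : toFree N empty = 1 := by
  have : empty.positions N = [] := positions_eq List.Pairwise.nil fun i => i.elim
  rw [toFree, this]
  rfl

theorem toFree_concat (N : ℕ) (W₁ W₂ : EarringWord) :
    toFree N (W₁.concat W₂) = toFree N W₁ * toFree N W₂ := by
  let inl : W₁.Carrier → (W₁.concat W₂).Carrier := fun i => toLex (Sum.inl i)
  let inr : W₂.Carrier → (W₁.concat W₂).Carrier := fun i => toLex (Sum.inr i)
  have : (W₁.concat W₂).positions N = (W₁.positions N).map inl ++ (W₂.positions N).map inr := by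
    refine positions_eq (List.pairwise_append.2 ⟨?_, ?_, ?_⟩) ?_
    · exact List.pairwise_map.2 ((W₁.pairwise_positions N).imp fun h => Sum.Lex.inl_lt_inl_iff.2 h)
    · exact List.pairwise_map.2 ((W₂.pairwise_positions N).imp fun h => Sum.Lex.inr_lt_inr_iff.2 h)
    · intro a ha b hb
      obtain ⟨i, -, rfl⟩ := List.mem_map.1 ha
      obtain ⟨j, -, rfl⟩ := List.mem_map.1 hb
      exact Sum.Lex.inl_lt_inr _ _
    · intro i
      rw [List.mem_append, List.mem_map, List.mem_map]
      constructor
      · rintro (⟨j, hj, rfl⟩ | ⟨j, hj, rfl⟩) <;>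
          · have h := mem_positions.1 hj
            exact h
      · have key : ∀ k : W₁.Carrier ⊕ W₂.Carrier,
            ((W₁.concat W₂).letter (toLex k : W₁.Carrier ⊕ₗ W₂.Carrier)).1 < N →
            (∃ a ∈ W₁.positions N, inl a = (toLex k : W₁.Carrier ⊕ₗ W₂.Carrier)) ∨
            (∃ a ∈ W₂.positions N, inr a = (toLex k : W₁.Carrier ⊕ₗ W₂.Carrier)) := by
          rintro (j | j) hj
          · exact Or.inl ⟨j, mem_positions.2 hj, rfl⟩
          · exact Or.inr ⟨j, mem_positions.2 hj, rfl⟩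
        exact key (ofLex (i : W₁.Carrier ⊕ₗ W₂.Carrier))
  rw [toFree, this, List.map_append, List.map_map, List.map_map, ← FreeGroup.mul_mk]
  rfl

theorem toFree_reverse (N : ℕ) (W : EarringWord) : toFree N W.reverse = (toFree N W)⁻¹ := by
  let d : W.Carrier → W.reverse.Carrier := fun i => OrderDual.toDual i
  have : W.reverse.positions N = ((W.positions N).map d).reverse := by
    refine positions_eq (List.pairwise_reverse.2 (List.pairwise_map.2
      ((W.pairwise_positions N).imp fun h => OrderDual.toDual_lt_toDual.2 h))) fun i => ?_
    rw [List.mem_reverse, List.mem_map]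
    constructor
    · rintro ⟨j, hj, rfl⟩
      have h := mem_positions.1 hj
      exact h
    · intro hi
      exact ⟨OrderDual.ofDual (i : W.Carrierᵒᵈ), mem_positions.2 hi, rfl⟩
  rw [toFree, this, toFree, FreeGroup.inv_mk, FreeGroup.invRev, List.map_reverse, List.map_map,
    List.map_map]
  rfl

theorem toFree_truncate (M N : ℕ) (W : EarringWord) :
    toFree M (W.truncate N) = toFree (min M N) W := by
  let v : (W.truncate N).Carrier → W.Carrier :=
    fun i => (i : {i : W.Carrier // (W.letter i).1 < N}).1
  have : W.positions (min M N) = ((W.truncate N).positions M).map v := by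
    refine positions_eq (List.pairwise_map.2 (((W.truncate N).pairwise_positions M).imp
      fun h => h)) fun i => ?_
    rw [List.mem_map, lt_min_iff]
    constructor
    · rintro ⟨j, hj, rfl⟩
      have h := mem_positions.1 hj
      exact ⟨h, j.2⟩
    · rintro ⟨h₁, h₂⟩
      exact ⟨(⟨i, h₂⟩ : {i : W.Carrier // (W.letter i).1 < N}), mem_positions.2 h₁, rfl⟩
  rw [toFree, toFree, this, List.map_map]
  rfl

end EarringWord

/-- The Hawaiian earring group: words modulo `∼`, under concatenation. -/
def EarringGroup : Type 1 := Quotient EarringWord.setoid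

namespace EarringGroup

/-- The class of a word. -/
def mk (W : EarringWord) : EarringGroup := Quotient.mk EarringWord.setoid W

instance : One EarringGroup := ⟨mk EarringWord.empty⟩

instance : Mul EarringGroup :=
  ⟨Quotient.map₂ EarringWord.concat fun _ _ h _ _ k N => by
    rw [EarringWord.toFree_concat, EarringWord.toFree_concat, h N, k N]⟩

instance : Inv EarringGroup :=
  ⟨Quotient.map EarringWord.reverse fun _ _ h N => by
    rw [EarringWord.toFree_reverse, EarringWord.toFree_reverse, h N]⟩

instance : Group EarringGroup :=
  Group.ofLeftAxioms
    (by
      rintro ⟨a⟩ ⟨b⟩ ⟨c⟩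
      exact Quotient.sound fun N => by simp only [EarringWord.toFree_concat, mul_assoc])
    (by
      rintro ⟨a⟩
      exact Quotient.sound fun N => by
        rw [EarringWord.toFree_concat, EarringWord.toFree_empty, one_mul])
    (by
      rintro ⟨a⟩
      exact Quotient.sound fun N => by
        rw [EarringWord.toFree_concat, EarringWord.toFree_reverse, EarringWord.toFree_empty,
          inv_mul_cancel])

/-- The retraction `p_N` of the Hawaiian earring group onto the free subgroup on
`a₀, …, a_{N-1}`, induced by deleting all letters of index `≥ N` from a word. -/
def retraction (N : ℕ) : EarringGroup →* EarringGroup :=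
  MonoidHom.mk'
    (Quotient.map (EarringWord.truncate N) fun _ _ h M => by
      rw [EarringWord.toFree_truncate, EarringWord.toFree_truncate, h])
    (by
      rintro ⟨a⟩ ⟨b⟩
      exact Quotient.sound fun M => by
        simp only [EarringWord.toFree_concat, EarringWord.toFree_truncate])

end EarringGroup

/-! ### The three notions of slenderness -/

/-- `G` is n-slender (noncommutatively slender): every homomorphism from the Hawaiian earring group
to `G` factors through one of the retractions `p_N`. -/
def NSlender (G : Type w) [Group G] : Prop :=
  ∀ φ : EarringGroup →* G, ∃ N : ℕ, φ = φ.comp (EarringGroup.retraction N)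

/-- `G` is cm-slender: every homomorphism from a completely metrizable topological group to `G` has
open kernel. -/
def CmSlender (G : Type w) [Group G] : Prop :=
  ∀ (H : Type x) [Group H] [TopologicalSpace H] [IsTopologicalGroup H]
    [TopologicalSpace.IsCompletelyMetrizableSpace H] (φ : H →* G), IsOpen (φ.ker : Set H)

/-- `G` is lcH-slender: every homomorphism from a locally compact Hausdorff topological group to `G`
has open kernel. -/
def LcHSlender (G : Type w) [Group G] : Prop :=
  ∀ (H : Type x) [Group H] [TopologicalSpace H] [IsTopologicalGroup H]
    [LocallyCompactSpace H] [T2Space H] (φ : H →* G), IsOpen (φ.ker : Set H)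

/-! ### Graph products and direct sums -/

/-- The graph product of the groups `G v` over the graph `Γ`: the quotient of the free product of
the `G v` by the relations making `G v` and `G w` commute whenever `v` and `w` are adjacent. -/
abbrev GraphProduct {V : Type u} (Γ : SimpleGraph V) (G : V → Type w) [∀ v, Group (G v)] :
    Type (max u w) :=
  Monoid.CoprodI G ⧸ Subgroup.normalClosure
    {c : Monoid.CoprodI G | ∃ (v v' : V) (g : G v) (g' : G v'), Γ.Adj v v' ∧
      c = Monoid.CoprodI.of g * Monoid.CoprodI.of g' *
        (Monoid.CoprodI.of g)⁻¹ * (Monoid.CoprodI.of g')⁻¹}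

/-- The direct sum of a family of (not necessarily abelian) groups: the subgroup of the product
consisting of the elements with finite support. -/
def directSumSubgroup {V : Type u} (G : V → Type w) [∀ v, Group (G v)] :
    Subgroup (∀ v, G v) where
  carrier := {f | {v | f v ≠ 1}.Finite}
  one_mem' := by simp
  mul_mem' {f g} hf hg := by
    refine (Set.Finite.union hf hg).subset fun v hv => ?_
    by_contra h
    obtain ⟨h₁, h₂⟩ := not_or.1 h
    exact hv (by rw [Pi.mul_apply, not_not.1 h₁, not_not.1 h₂, one_mul])
  inv_mem' {f} hf := by simpa using hf

/-! Each of the three notions says that homomorphisms from certain test groups have large kernel: a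
neighbourhood of `1`, or, in the earring group, a set containing all classes of words in letters of
large index. Two properties of the test groups suffice (`IsTestClass`): equations `h n = g n * h (n
+ 1) ^ k` are solvable with each `g n` taken close to `1` depending on its predecessors, and one can
pass to a large subgroup.

Such infinite products yield two criteria. If powers of nontrivial elements are long, exponents
outgrowing the lengths of the factors lead to a contradiction (`SlenderFor.of_length`). If every
element has a finite support and the retractions onto finite supports are tame, one builds a product
whose tails vanish on the supports of the earlier factors, and its own support cannot be finite
(`SlenderFor.of_retractions`).

It remains to show that the retraction of a graph product `P` onto finitely many vertices is tame,
adding one vertex `v` at a time. `P` embeds in the semidirect product, with `P` acting, of a free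
product of copies of `G v` indexed by the cosets of the link of `v`. An element killed by the
retraction away from `v` and by the projection to `G v` lands in this free product, in the kernel of
the folding map to `G v`. Folding is injective on each factor, so a nontrivial element of its kernel
is not conjugate into a factor and its powers grow in syllable length: the first criterion applies.
Tameness passes through extensions by slender kernels (`TameHom.of_slender_ker`), which gives the
induction, and the second criterion concludes.

Free products are the edgeless case; direct sums follow directly from the second criterion. -/

open Filter

/-! ### Slenderness relative to a class of test groups -/

/-- The first `n` terms of a sequence, the most recent one first. -/
def history {α : Type*} (g : ℕ → α) : ℕ → List α
  | 0 => []
  | n + 1 => g n :: history g n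

theorem length_history {α : Type*} (g : ℕ → α) (n : ℕ) : (history g n).length = n := by
  induction n with
  | zero => rfl
  | succ n ih => simp [history, ih]

/-- Recursive choice with access to all earlier terms: the recursion runs on the lists, and the
sequence is read off afterwards. -/
theorem exists_sequence_of_history {α : Type*} {p : List α → α → Prop} (hp : ∀ l, ∃ a, p l a) :
    ∃ g : ℕ → α, ∀ n, p (history g n) (g n) := by
  choose f hf using hp
  let H : ℕ → List α := fun n => Nat.rec [] (fun _ l => f l :: l) n
  have key : ∀ n, history (fun n => f (H n)) n = H n := by
    intro n
    induction n with
    | zero => rfl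
    | succ n ih => rw [history, ih]
  exact ⟨fun n => f (H n), fun n => by rw [key]; exact hf _⟩

/-- Infinite products can be formed in `H` along any sequence that is chosen step by step close
enough to `1`, closeness being measured by the filter `N`. -/
def HasInfiniteProducts (H : Type x) [Group H] (N : Filter H) : Prop :=
  ∀ A : Set H, (∀ U ∈ N, (A ∩ U).Nonempty) →
    ∀ V : List H → Subgroup H, (∀ l, (V l : Set H) ∈ N) → ∀ k : List H → ℕ,
      ∃ g h : ℕ → H, ∀ n, g n ∈ A ∧ h n ∈ V (history g n) ∧
        h n = g n * h (n + 1) ^ k (history g (n + 1))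

/-- A class of groups, each with a filter playing the role of the neighbourhoods of `1`, in which
infinite products can be formed and which is closed under passing to small subgroups. -/
structure IsTestClass (C : (H : Type x) → [Group H] → Filter H → Prop) : Prop where
  hasInfiniteProducts : ∀ (H : Type x) [Group H] (N : Filter H), C H N → HasInfiniteProducts H N
  -- The filter inequality makes a set large in `H` once its preimage under `s` is large in `H'`.
  -- For topological groups `s` is the inclusion of an open subgroup; for the earring group it is a
  -- shift of the letters.
  restrict : ∀ (H : Type x) [Group H] (N : Filter H), C H N → ∀ U : Subgroup H, (U : Set H) ∈ N →
    ∃ (H' : Type x) (_ : Group H') (N' : Filter H') (s : H' →* H),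
      C H' N' ∧ (∀ y, s y ∈ U) ∧ N ≤ N'.map s

/-- A homomorphism `α` is tame if the kernel of `α ∘ φ` is small for all homomorphisms `φ` from
test groups. -/
def TameHom (C : (H : Type x) → [Group H] → Filter H → Prop) {P : Type u} {Q : Type w} [Group P]
    [Group Q] (α : P →* Q) : Prop :=
  ∀ (H : Type x) [Group H] (N : Filter H), C H N → ∀ φ : H →* P, ((α.comp φ).ker : Set H) ∈ N

/-- A group is slender relative to a test class if all homomorphisms from test groups have small
kernels. -/
def SlenderFor (C : (H : Type x) → [Group H] → Filter H → Prop) (G : Type w) [Group G] : Prop :=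
  ∀ (H : Type x) [Group H] (N : Filter H), C H N → ∀ φ : H →* G, (φ.ker : Set H) ∈ N

section

variable {C : (H : Type x) → [Group H] → Filter H → Prop}

theorem SlenderFor.tameHom {P : Type u} {Q : Type w} [Group P] [Group Q] (hQ : SlenderFor C Q)
    (α : P →* Q) : TameHom C α :=
  fun H _ N hN φ => hQ H N hN (α.comp φ)

theorem SlenderFor.of_injective {P : Type u} {Q : Type w} [Group P] [Group Q]
    (hQ : SlenderFor C Q) (f : P →* Q) (hf : Function.Injective f) : SlenderFor C P := by
  intro H _ N hN φ
  refine mem_of_superset (hQ H N hN (f.comp φ)) fun y hy => ?_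
  have hy' : f (φ y) = 1 := hy
  exact hf (hy'.trans (map_one f).symm)

theorem TameHom.prod {P : Type u} {Q Q' : Type*} [Group P] [Group Q] [Group Q'] {α : P →* Q}
    {β : P →* Q'} (hα : TameHom C α) (hβ : TameHom C β) : TameHom C (α.prod β) := by
  intro H _ N hN φ
  refine mem_of_superset (inter_mem (hα H N hN φ) (hβ H N hN φ)) fun y hy => ?_
  have h₁ : α (φ y) = 1 := hy.1
  have h₂ : β (φ y) = 1 := hy.2
  change (α.prod β) (φ y) = 1
  rw [MonoidHom.prod_apply, h₁, h₂, Prod.mk_one_one]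

/-- Extensions: `α` is tame if some `β` is and `α` maps the kernel of `β` to a slender group. -/
theorem TameHom.of_slender_ker (hC : IsTestClass C) {P : Type u} {Q : Type w} {Q' : Type*}
    [Group P] [Group Q] [Group Q'] {α : P →* Q} {β : P →* Q'} (hβ : TameHom C β)
    {K : Subgroup Q} (hK : SlenderFor C K) (hαβ : ∀ y, β y = 1 → α y ∈ K) : TameHom C α := by
  intro H _ N hN φ
  -- Along `s` the homomorphism `φ` lands in the kernel of `β`, so `α ∘ φ ∘ s` lands in `K`, where
  -- slenderness applies; `hle` carries the large kernel back to `H`.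
  obtain ⟨H', _, N', s, hN', hs, hle⟩ := hC.restrict H N hN _ (hβ H N hN φ)
  refine hle (mem_map.2 ?_)
  let f : H' →* K := ((α.comp φ).comp s).codRestrict K fun y => hαβ _ (hs y)
  refine mem_of_superset (hK H' N' hN' f) fun y hy => ?_
  exact congrArg Subtype.val (show f y = 1 from hy)

/-- A group with a length function that grows along powers is slender. -/
theorem SlenderFor.of_length (hC : IsTestClass C) {K : Type w} [Group K] (L : K → ℕ)
    (hL_one : L 1 = 0) (hL_mul : ∀ a b, L (a * b) ≤ L a + L b)
    (hL_pow : ∀ a, a ≠ 1 → ∀ k, 1 ≤ k → k ≤ L (a ^ k) ∧ L a ≤ L (a ^ k)) : SlenderFor C K := by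
  intro H _ N hN φ
  by_contra hker
  have hA : ∀ U ∈ N, ({y | φ y ≠ 1} ∩ U).Nonempty := by
    intro U hU
    by_contra hne
    refine hker (mem_of_superset hU fun y hy => ?_)
    by_contra hy'
    exact hne ⟨y, hy', hy⟩
  -- No closeness is required here. The exponent sums the lengths of the inverses of all factors so
  -- far, plus `1` for each factor; these extra units eventually exceed the length of `φ (h 0)`.
  obtain ⟨g, h, hgh⟩ := hC.hasInfiniteProducts H N hN _ hA (fun _ => ⊤) (fun _ => by simp)
    (fun l => (l.map fun y => L (φ y)⁻¹ + 1).sum)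
  set S : ℕ → ℕ := fun n => ((history g n).map fun y => L (φ y)⁻¹ + 1).sum with hS
  have hS_succ : ∀ n, S (n + 1) = L (φ (g n))⁻¹ + 1 + S n := fun n => by
    simp only [hS, history, List.map_cons, List.sum_cons]
  have hS_le : ∀ n, n ≤ S n := by
    intro n
    induction n with
    | zero => exact Nat.zero_le _
    | succ n ih => rw [hS_succ]; omega
  have hrec : ∀ n, φ (h n) = φ (g n) * φ (h (n + 1)) ^ S (n + 1) := fun n => by
    rw [← map_pow, ← map_mul, ← (hgh n).2.2]
  have hpow : ∀ n, L (φ (h (n + 1)) ^ S (n + 1)) ≤ L (φ (g n))⁻¹ + L (φ (h n)) := fun n => by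
    have : φ (h (n + 1)) ^ S (n + 1) = (φ (g n))⁻¹ * φ (h n) := by rw [hrec n]; group
    rw [this]
    exact hL_mul _ _
  have hstep : ∀ n, L (φ (h (n + 1))) ≤ L (φ (g n))⁻¹ + L (φ (h n)) := fun n => by
    by_cases h1 : φ (h (n + 1)) = 1
    · rw [h1, hL_one]; exact Nat.zero_le _
    · exact (hL_pow _ h1 _ (le_trans (by omega) (hS_le (n + 1)))).2.trans (hpow n)
  have hbound : ∀ n, L (φ (h n)) + n ≤ S n + L (φ (h 0)) := by
    intro n
    induction n with
    | zero => omega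
    | succ n ih => have := hstep n; rw [hS_succ]; omega
  -- Otherwise the exponent `S (n + 1)` would be at most `L (φ (g n))⁻¹ + S n + L (φ (h 0)) - n`,
  -- which is less than `S (n + 1)`.
  have htriv : ∀ n, L (φ (h 0)) < n → φ (h (n + 1)) = 1 := by
    intro n hn
    by_contra h1
    have h2 := (hL_pow _ h1 _ (le_trans (by omega) (hS_le (n + 1)))).1.trans (hpow n)
    have h3 := hbound n
    rw [hS_succ] at h2
    omega
  refine (hgh (L (φ (h 0)) + 2)).1 ?_
  have := hrec (L (φ (h 0)) + 2)
  rwa [htriv (L (φ (h 0)) + 1) (by omega), htriv (L (φ (h 0)) + 2) (by omega), one_pow, mul_one,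
    eq_comm] at this

/-- A group in which every element is fixed by one of a compatible family of tame retractions
indexed by finite sets is slender. -/
theorem SlenderFor.of_retractions (hC : IsTestClass C) {V : Type*} {P : Type w} [Group P]
    (ρ : Set V → P →* P) (hρ : ∀ S T x, ρ S (ρ T x) = ρ (S ∩ T) x)
    (hfix : ∀ x, ∃ F : Finset V, ρ F x = x) (htame : ∀ F : Finset V, TameHom C (ρ F)) :
    SlenderFor C P := by
  classical
  intro H _ N hN φ
  by_contra hker
  have hA : ∀ U ∈ N, ({y | φ y ≠ 1} ∩ U).Nonempty := by
    intro U hU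
    by_contra hne
    refine hker (mem_of_superset hU fun y hy => ?_)
    by_contra hy'
    exact hne ⟨y, hy', hy⟩
  choose supp hsupp using hfix
  have hfix_of_subset : ∀ x (T : Set V), ↑(supp x) ⊆ T → ρ T x = x := fun x T hT => by
    conv_lhs => rw [← hsupp x]
    rw [hρ, Set.inter_eq_right.2 hT, hsupp]
  -- Each tail `h n` is required to be killed by the retraction onto the union of the supports of
  -- the preceding factors. The exponents are all `1`.
  let F : List H → Finset V := fun l => l.foldr (fun y E => supp (φ y) ∪ E) ∅
  obtain ⟨g, h, hgh⟩ := hC.hasInfiniteProducts H N hN _ hA (fun l => ((ρ (F l)).comp φ).ker)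
    (fun l => htame (F l) H N hN φ) (fun _ => 1)
  set E : ℕ → Finset V := fun n => F (history g n) with hE
  have hE_succ : ∀ n, E (n + 1) = supp (φ (g n)) ∪ E n := fun n => rfl
  have hker' : ∀ n, ρ (E n) (φ (h n)) = 1 := fun n => (hgh n).2.1
  have hrec : ∀ n, h n = g n * h (n + 1) := fun n => by simpa using (hgh n).2.2
  have hEmono : Monotone E := monotone_nat_of_le_succ fun n => by
    rw [hE_succ]; exact Finset.subset_union_right
  let p : ℕ → P := fun n => Nat.rec 1 (fun m q => q * φ (g m)) n
  have hp_succ : ∀ n, p (n + 1) = p n * φ (g n) := fun n => rfl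
  have hp : ∀ n, φ (h 0) = p n * φ (h n) := by
    intro n
    induction n with
    | zero => exact (one_mul _).symm
    | succ n ih => rw [ih, hp_succ, mul_assoc, ← map_mul, ← hrec]
  have hpE : ∀ n, ρ (E n) (p n) = p n := by
    -- Stated for all larger `T`, since `E` grows during the induction.
    have hp' : ∀ n, ∀ T : Set V, ↑(E n) ⊆ T → ρ T (p n) = p n := by
      intro n
      induction n with
      | zero => exact fun T _ => map_one _
      | succ n ih =>
        intro T hT
        rw [hE_succ, Finset.coe_union, Set.union_subset_iff] at hT
        rw [hp_succ, map_mul, ih T hT.2, hfix_of_subset _ T hT.1]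
    exact fun n => hp' n _ subset_rfl
  -- The partial product `p n` is recovered from `φ (h 0)` through `E n ∩ supp (φ (h 0))` alone.
  -- This increasing chain lies in a finite set, so two consecutive partial products agree and `φ (g
  -- n) = 1`.
  have hval : ∀ n, ρ (E n ∩ supp (φ (h 0)) : Set V) (φ (h 0)) = p n := fun n => by
    rw [← hρ, hsupp]
    conv_lhs => rw [hp n, map_mul, hker' n, mul_one, hpE]
  obtain ⟨n, hn⟩ : ∃ n, E (n + 1) ∩ supp (φ (h 0)) = E n ∩ supp (φ (h 0)) := by
    by_contra! hne
    have hlt : StrictMono fun n => (E n ∩ supp (φ (h 0))).card :=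
      strictMono_nat_of_lt_succ fun n => Finset.card_lt_card
        ((Finset.inter_subset_inter_right (hEmono n.le_succ)).ssubset_of_ne (hne n).symm)
    have h₁ := hlt.le_apply (x := (supp (φ (h 0))).card + 1)
    have h₂ := Finset.card_le_card
      (Finset.inter_subset_right (s₁ := E ((supp (φ (h 0))).card + 1)) (s₂ := supp (φ (h 0))))
    omega
  refine (hgh n).1 ?_
  have h₁ := hval n
  have h₂ := hval (n + 1)
  rw [← Finset.coe_inter] at h₁ h₂
  rw [hn, h₁, hp_succ] at h₂
  simpa using h₂.symm

end

/-! ### Kernels in free products -/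

namespace Monoid.CoprodI

/-! ### Reduced words and syllable length -/

section Monoid

variable {ι : Type*} {M : ι → Type*} [∀ i, Monoid (M i)]

namespace NeWord

/-- The number of syllables of a nonempty reduced word. -/
def length {i j : ι} (w : NeWord M i j) : ℕ := w.toList.length

@[simp]
theorem length_singleton {i : ι} (x : M i) (hx : x ≠ 1) : (singleton x hx).length = 1 := rfl

@[simp]
theorem length_append {i j k l : ι} (w₁ : NeWord M i j) (hne : j ≠ k) (w₂ : NeWord M k l) :
    (append w₁ hne w₂).length = w₁.length + w₂.length := List.length_append

theorem length_pos {i j : ι} (w : NeWord M i j) : 0 < w.length :=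
  List.length_pos_iff.2 w.toList_ne_nil

/-- A `NeWord` is a binary tree of concatenations, so isolating its first syllable takes an
induction; only product and length are tracked. -/
theorem eq_singleton_or_cons {i j : ι} (w : NeWord M i j) :
    (i = j ∧ w.length = 1 ∧ ∃ x : M i, x ≠ 1 ∧ w.prod = of x) ∨
      ∃ (k : ι) (x : M i) (_ : x ≠ 1) (_ : i ≠ k) (v : NeWord M k j),
        w.prod = of x * v.prod ∧ w.length = v.length + 1 := by
  induction w with
  | singleton x hx => exact Or.inl ⟨rfl, rfl, x, hx, prod_singleton x hx⟩
  | append w₁ hne w₂ ih₁ _ =>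
    right
    rcases ih₁ with ⟨rfl, hlen, x, hx, hprod⟩ | ⟨k, x, hx, hk, v, hprod, hlen⟩
    · exact ⟨_, x, hx, hne, w₂, by rw [append_prod, hprod], by rw [length_append, hlen, add_comm]⟩
    · exact ⟨k, x, hx, hk, append v hne w₂, by rw [append_prod, append_prod, hprod, mul_assoc],
        by rw [length_append, length_append, hlen]; omega⟩

theorem eq_singleton_or_concat {i j : ι} (w : NeWord M i j) :
    (i = j ∧ w.length = 1 ∧ ∃ x : M j, x ≠ 1 ∧ w.prod = of x) ∨
      ∃ (k : ι) (x : M j) (_ : x ≠ 1) (_ : k ≠ j) (v : NeWord M i k),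
        w.prod = v.prod * of x ∧ w.length = v.length + 1 := by
  induction w with
  | singleton x hx => exact Or.inl ⟨rfl, rfl, x, hx, prod_singleton x hx⟩
  | append w₁ hne w₂ _ ih₂ =>
    right
    rcases ih₂ with ⟨rfl, hlen, x, hx, hprod⟩ | ⟨k, x, hx, hk, v, hprod, hlen⟩
    · exact ⟨_, x, hx, hne, w₁, by rw [append_prod, hprod], by rw [length_append, hlen]⟩
    · exact ⟨k, x, hx, hk, append w₁ hne v, by rw [append_prod, append_prod, hprod, mul_assoc],
        by rw [length_append, length_append, hlen]; omega⟩

theorem exists_pow_succ {i j : ι} (w : NeWord M i j) (hne : j ≠ i) (n : ℕ) :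
    ∃ v : NeWord M i j, v.prod = w.prod ^ (n + 1) ∧ v.length = (n + 1) * w.length := by
  induction n with
  | zero => exact ⟨w, by simp, by simp⟩
  | succ n ih =>
    obtain ⟨v, hv, hlen⟩ := ih
    exact ⟨append w hne v, by rw [append_prod, hv, ← pow_succ'],
      by rw [length_append, hlen]; ring⟩

end NeWord

open Classical in
/-- The number of syllables in the reduced form of an element of a free product. -/
noncomputable def syllableLength (g : CoprodI M) : ℕ := (Word.equiv g).toList.length

theorem syllableLength_prod (w : Word M) : syllableLength w.prod = w.toList.length := by
  classical
  have : Word.equiv w.prod = w := Word.equiv.apply_symm_apply w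
  rw [syllableLength]
  convert congrArg (fun v : Word M => v.toList.length) this

theorem syllableLength_neWord_prod {i j : ι} (w : NeWord M i j) :
    syllableLength w.prod = w.length := syllableLength_prod w.toWord

theorem exists_prod_eq (g : CoprodI M) : ∃ w : Word M, w.prod = g := by
  classical
  exact ⟨Word.equiv g, Word.equiv.symm_apply_apply g⟩

theorem syllableLength_one : syllableLength (1 : CoprodI M) = 0 := by
  rw [← Word.prod_empty, syllableLength_prod]
  rfl

/-- A syllable multiplied on the left is either prepended, or merged with the first syllable, or
cancels it. -/
theorem syllableLength_of_mul_le {i : ι} (x : M i) (g : CoprodI M) :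
    syllableLength (of x * g) ≤ syllableLength g + 1 := by
  classical
  obtain ⟨w, rfl⟩ := exists_prod_eq g
  by_cases hx : x = 1
  · simp [hx]
  by_cases hw : w.fstIdx = some i
  · obtain ⟨l, hne, hchain⟩ := w
    cases l with
    | nil => simp [Word.fstIdx] at hw
    | cons y l =>
      obtain ⟨j, y⟩ := y
      obtain rfl : j = i := by simpa [Word.fstIdx] using hw
      let w' : Word M := ⟨l, fun z hz => hne z (List.mem_cons_of_mem _ hz), hchain.tail⟩
      have hprod : of x * Word.prod ⟨⟨j, y⟩ :: l, hne, hchain⟩ = of (x * y) * w'.prod := by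
        simp [Word.prod, w', mul_assoc]
      rw [hprod, syllableLength_prod]
      by_cases hxy : x * y = 1
      · rw [hxy, map_one, one_mul, syllableLength_prod]
        simp only [w', List.length_cons]
        omega
      · have hw' : w'.fstIdx ≠ some j := by
          rw [Word.fstIdx_ne_iff]
          exact fun z hz => (List.isChain_cons.1 hchain).1 z hz
        rw [← Word.prod_cons j (x * y) w' hxy hw', syllableLength_prod]
        simp [w', Word.cons]
  · rw [← Word.prod_cons i x w hx hw, syllableLength_prod, syllableLength_prod]
    simp [Word.cons]

theorem syllableLength_mul_le (a b : CoprodI M) :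
    syllableLength (a * b) ≤ syllableLength a + syllableLength b := by
  obtain ⟨⟨l, hne, hchain⟩, rfl⟩ := exists_prod_eq a
  rw [syllableLength_prod]
  have key : ∀ l : List (Σ i, M i), syllableLength ((l.map fun y => of y.2).prod * b) ≤
      l.length + syllableLength b := by
    intro l
    induction l with
    | nil => simp
    | cons y l ih =>
      rw [List.map_cons, List.prod_cons, mul_assoc, List.length_cons]
      have := syllableLength_of_mul_le y.2 ((l.map fun y => of y.2).prod * b)
      omega
  exact key l

end Monoid

section Group

variable {ι : Type*} {G : ι → Type*} [∀ i, Group (G i)] {Q : Type*} [Group Q]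

/-- If `f` is injective on the factors, the reduced form of a nontrivial element of its kernel
keeps its first and last index under powers, and grows. -/
theorem NeWord.exists_pow_of_ker (f : CoprodI G →* Q)
    (hf : ∀ (i : ι) (x : G i), f (of x) = 1 → x = 1) (n : ℕ) :
    ∀ {i j : ι} (w : NeWord G i j), w.length ≤ n → f w.prod = 1 → ∀ k, 1 ≤ k →
      ∃ v : NeWord G i j, v.prod = w.prod ^ k ∧ k ≤ v.length ∧ w.length ≤ v.length := by
  induction n using Nat.strong_induction_on with
  | _ n ih =>
  intro i j w hn hw k hk
  obtain ⟨k, rfl⟩ := Nat.exists_eq_add_of_le' hk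
  -- With different end indices, copies of `w` concatenate without reduction.
  by_cases hij : j = i
  swap
  · obtain ⟨v, hv, hlen⟩ := w.exists_pow_succ hij k
    have := w.length_pos
    exact ⟨v, hv, hlen ▸ Nat.le_mul_of_pos_right _ this,
      hlen ▸ Nat.le_mul_of_pos_left _ k.succ_pos⟩
  subst hij
  rcases k with _ | k
  · exact ⟨w, by simp, w.length_pos, le_rfl⟩
  -- A single syllable is excluded by injectivity of `f` on the factors, so `w` has the form `x v y`
  -- with `x` and `y` in the same factor.
  rcases w.eq_singleton_or_cons with ⟨-, -, x, hx, hprod⟩ | ⟨m, x, hx, hm, u, hprod, hlen⟩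
  · exact absurd (hf _ x (hprod ▸ hw)) hx
  rcases u.eq_singleton_or_concat with ⟨hmj, -⟩ | ⟨q, y, hy, hq, v, hprod', hlen'⟩
  · exact absurd hmj.symm hm
  rw [hprod'] at hprod
  have hvpos := v.length_pos
  -- Here `w` is the conjugate of `v` by `x`, and `v` is a shorter word in the kernel. The
  -- conjugation stays reduced because the power of `v` keeps its end indices.
  by_cases hyx : y * x = 1
  · obtain rfl := eq_inv_of_mul_eq_one_left hyx
    have hv : f v.prod = 1 := by
      have := hw
      rw [hprod, map_mul, map_mul, map_inv, map_inv] at this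
      rw [← mul_assoc, mul_inv_eq_one] at this
      exact mul_eq_left.1 this
    obtain ⟨v', hv', hk', hl'⟩ := ih v.length (by omega) v le_rfl hv (k + 1 + 1) hk
    refine ⟨append (singleton x hx) hm (append v' hq (singleton x⁻¹ hy)), ?_, ?_, ?_⟩
    · rw [append_prod, append_prod, prod_singleton, prod_singleton, hv', hprod, map_inv,
        ← mul_assoc, ← mul_assoc, conj_pow]
    · simp only [length_append, length_singleton]; omega
    · simp only [length_append, length_singleton]; omega
  -- The reduced form comes from `(x v y) ^ (k + 2) = x (v (y x)) ^ (k + 1) v y`.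
  · obtain ⟨p, hp, hpl⟩ := (append v hq (singleton (y * x) hyx)).exists_pow_succ hm k
    refine ⟨append (singleton x hx) hm (append p hm (append v hq (singleton y hy))), ?_, ?_, ?_⟩
    · rw [append_prod, append_prod, append_prod, prod_singleton, prod_singleton, hp, hprod,
        append_prod, prod_singleton, map_mul, pow_succ (_ * _) (k + 1), ← mul_assoc,
        ← mul_assoc v.prod, ← mul_pow_mul]
      simp only [mul_assoc]
    · have : k + 1 ≤ p.length := by
        rw [hpl]; exact Nat.le_mul_of_pos_right _ (length_pos _)
      simp only [length_append, length_singleton]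
      omega
    · simp only [length_append, length_singleton]
      omega

theorem syllableLength_pow (f : CoprodI G →* Q)
    (hf : ∀ (i : ι) (x : G i), f (of x) = 1 → x = 1) {g : CoprodI G} (hg : f g = 1)
    (hg1 : g ≠ 1) {k : ℕ} (hk : 1 ≤ k) :
    k ≤ syllableLength (g ^ k) ∧ syllableLength g ≤ syllableLength (g ^ k) := by
  obtain ⟨w, rfl⟩ := exists_prod_eq g
  have hw : w ≠ Word.empty := by
    rintro rfl
    exact hg1 Word.prod_empty
  obtain ⟨i, j, w, rfl⟩ := NeWord.of_word w hw
  obtain ⟨v, hv, h₁, h₂⟩ := NeWord.exists_pow_of_ker f hf w.length w le_rfl hg k hk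
  change k ≤ syllableLength (w.prod ^ k) ∧ syllableLength w.prod ≤ syllableLength (w.prod ^ k)
  rw [← hv, syllableLength_neWord_prod, syllableLength_neWord_prod]
  exact ⟨h₁, h₂⟩

/-- The kernel of a homomorphism that is injective on the factors of a free product is slender. -/
theorem slenderFor_ker {C : (H : Type x) → [Group H] → Filter H → Prop} (hC : IsTestClass C)
    (f : CoprodI G →* Q) (hf : ∀ (i : ι) (x : G i), f (of x) = 1 → x = 1) :
    SlenderFor C f.ker :=
  SlenderFor.of_length hC (fun g => syllableLength g.1) syllableLength_one
    (fun a b => syllableLength_mul_le a.1 b.1)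
    (fun a ha _ hk => syllableLength_pow f hf a.2 (fun h => ha (Subtype.ext h)) hk)

end Group

end Monoid.CoprodI

/-! ### Permuting the factors of a free power -/

namespace Monoid.CoprodI

variable {P : Type*} [Group P] {X : Type*} [MulAction P X] {G : Type*} [Group G]

/-- The endomorphism of a free power of `G` moving the factors by `p`. -/
def permuteHom (p : P) : CoprodI (fun _ : X => G) →* CoprodI (fun _ : X => G) :=
  lift fun c => of (M := fun _ : X => G) (i := p • c)

theorem permuteHom_of (p : P) (c : X) (g : G) :
    permuteHom p (of (M := fun _ : X => G) (i := c) g) =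
      of (M := fun _ : X => G) (i := p • c) g :=
  lift_of _ _

theorem permuteHom_mul (p q : P) :
    permuteHom (X := X) (G := G) (p * q) = (permuteHom p).comp (permuteHom q) := by
  refine ext_hom _ _ fun c => MonoidHom.ext fun g => ?_
  simp only [MonoidHom.comp_apply, permuteHom_of, mul_smul]

theorem permuteHom_one : permuteHom (X := X) (G := G) (1 : P) = MonoidHom.id _ := by
  refine ext_hom _ _ fun c => MonoidHom.ext fun g => ?_
  simp only [MonoidHom.comp_apply, permuteHom_of, one_smul, MonoidHom.id_apply]

/-- The action of `P` on a free power of `G` permuting the factors. -/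
def permute : P →* MulAut (CoprodI fun _ : X => G) where
  toFun p := MonoidHom.toMulEquiv (permuteHom p) (permuteHom p⁻¹)
    (by rw [← permuteHom_mul, inv_mul_cancel, permuteHom_one])
    (by rw [← permuteHom_mul, mul_inv_cancel, permuteHom_one])
  map_one' := MulEquiv.ext fun y => by
    change permuteHom 1 y = y
    rw [permuteHom_one, MonoidHom.id_apply]
  map_mul' p q := MulEquiv.ext fun y => by
    change permuteHom (p * q) y = permuteHom p (permuteHom q y)
    rw [permuteHom_mul, MonoidHom.comp_apply]

theorem permute_apply (p : P) (y : CoprodI fun _ : X => G) : permute p y = permuteHom p y := rfl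

/-- The homomorphism from a free power of `G` to `G` which is the identity on each factor. -/
def fold : CoprodI (fun _ : X => G) →* G := lift fun _ => MonoidHom.id G

theorem fold_of (c : X) (g : G) : fold (of (M := fun _ : X => G) (i := c) g) = g := lift_of _ _

theorem fold_permute (p : P) (y : CoprodI fun _ : X => G) : fold (permute p y) = fold y := by
  have : fold.comp (permuteHom p) = fold (X := X) (G := G) :=
    ext_hom _ _ fun c => MonoidHom.ext fun g => by
      simp only [MonoidHom.comp_apply, permuteHom_of, fold_of]
  exact DFunLike.congr_fun this y

end Monoid.CoprodI

/-! ### Graph products -/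

namespace GraphProduct

open Monoid

variable {V : Type u} {Γ : SimpleGraph V} {G : V → Type w} [∀ v, Group (G v)]

/-- The inclusion of a vertex group. -/
def of (v : V) : G v →* GraphProduct Γ G := (QuotientGroup.mk' _).comp CoprodI.of

theorem commute_of {v v' : V} (h : Γ.Adj v v') (g : G v) (g' : G v') :
    Commute (of (Γ := Γ) v g) (of v' g') := by
  have : (QuotientGroup.mk (CoprodI.of g * CoprodI.of g' * (CoprodI.of g)⁻¹ *
      (CoprodI.of g')⁻¹) : GraphProduct Γ G) = 1 :=
    (QuotientGroup.eq_one_iff _).2 (Subgroup.subset_normalClosure ⟨v, v', g, g', h, rfl⟩)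
  rw [QuotientGroup.mk_mul, QuotientGroup.mk_mul, QuotientGroup.mk_mul, QuotientGroup.mk_inv,
    QuotientGroup.mk_inv] at this
  rw [mul_inv_eq_one, mul_inv_eq_iff_eq_mul] at this
  exact this

/-- The universal property of the graph product. -/
def lift {Q : Type*} [Group Q] (f : ∀ v, G v →* Q)
    (hf : ∀ v v', Γ.Adj v v' → ∀ g g', Commute (f v g) (f v' g')) : GraphProduct Γ G →* Q :=
  QuotientGroup.lift _ (CoprodI.lift f) (by
    refine Subgroup.normalClosure_le_normal (N := (CoprodI.lift f).ker) ?_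
    rintro _ ⟨v, v', g, g', h, rfl⟩
    change CoprodI.lift f _ = 1
    simp only [map_mul, map_inv, CoprodI.lift_of]
    rw [mul_inv_eq_one, mul_inv_eq_iff_eq_mul]
    exact hf v v' h g g')

@[simp]
theorem lift_of {Q : Type*} [Group Q] (f : ∀ v, G v →* Q)
    (hf : ∀ v v', Γ.Adj v v' → ∀ g g', Commute (f v g) (f v' g')) (v : V) (g : G v) :
    lift f hf (of v g) = f v g :=
  CoprodI.lift_of f g

theorem hom_ext {Q : Type*} [Monoid Q] {α β : GraphProduct Γ G →* Q}
    (h : ∀ v g, α (of v g) = β (of v g)) : α = β :=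
  QuotientGroup.monoidHom_ext _ (CoprodI.ext_hom _ _ fun v => MonoidHom.ext fun g => h v g)

open Classical in
/-- The retraction onto the graph product over a set of vertices. -/
noncomputable def retract (S : Set V) : GraphProduct Γ G →* GraphProduct Γ G :=
  lift (fun v => if v ∈ S then of v else 1) fun v v' h g g' => by
    split_ifs
    · exact commute_of h g g'
    · exact Commute.one_right _
    · exact Commute.one_left _
    · exact Commute.one_left _

theorem retract_of_mem {S : Set V} {v : V} (hv : v ∈ S) (g : G v) :
    retract S (of (Γ := Γ) v g) = of v g := by
  rw [retract, lift_of, if_pos hv]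

theorem retract_of_notMem {S : Set V} {v : V} (hv : v ∉ S) (g : G v) :
    retract S (of (Γ := Γ) v g) = 1 := by
  rw [retract, lift_of, if_neg hv, MonoidHom.one_apply]

theorem retract_retract (S T : Set V) (y : GraphProduct Γ G) :
    retract S (retract T y) = retract (S ∩ T) y := by
  have : (retract S).comp (retract T) = retract (Γ := Γ) (G := G) (S ∩ T) := by
    refine hom_ext fun v g => ?_
    rw [MonoidHom.comp_apply]
    by_cases hT : v ∈ T
    · rw [retract_of_mem hT]
      by_cases hS : v ∈ S
      · rw [retract_of_mem hS, retract_of_mem (S := S ∩ T) ⟨hS, hT⟩]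
      · rw [retract_of_notMem hS, retract_of_notMem (S := S ∩ T) fun h => hS h.1]
    · rw [retract_of_notMem hT, map_one, retract_of_notMem (S := S ∩ T) fun h => hT h.2]
  exact DFunLike.congr_fun this y

theorem retract_empty (y : GraphProduct Γ G) : retract ∅ y = 1 := by
  have : retract (Γ := Γ) (G := G) ∅ = 1 :=
    hom_ext fun v g => retract_of_notMem (Set.notMem_empty v) g
  rw [this, MonoidHom.one_apply]

theorem exists_retract_eq (y : GraphProduct Γ G) : ∃ F : Finset V, retract F y = y := by
  classical
  -- Asserting this for every `S` containing `F` lets the supports of two factors be united.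
  have key : ∀ z : CoprodI G, ∃ F : Finset V, ∀ S : Set V, ↑F ⊆ S →
      retract S (QuotientGroup.mk z : GraphProduct Γ G) = QuotientGroup.mk z := by
    intro z
    induction z using CoprodI.induction_on with
    | one => exact ⟨∅, fun S _ => map_one _⟩
    | of v g => exact ⟨{v}, fun S hS => retract_of_mem (Γ := Γ) (by simpa using hS) g⟩
    | mul a b ha hb =>
      obtain ⟨E, hE⟩ := ha
      obtain ⟨F, hF⟩ := hb
      refine ⟨E ∪ F, fun S hS => ?_⟩
      rw [Finset.coe_union, Set.union_subset_iff] at hS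
      rw [QuotientGroup.mk_mul, map_mul, hE S hS.1, hF S hS.2]
  obtain ⟨z, rfl⟩ := QuotientGroup.mk_surjective y
  exact (key z).imp fun F hF => hF _ subset_rfl

theorem commute_mulSingle [DecidableEq V] {v v' : V} (h : v ≠ v') (g : G v) (g' : G v') :
    Commute (MonoidHom.mulSingle G v g) (MonoidHom.mulSingle G v' g') :=
  Pi.mulSingle_commute h g g'

open Classical in
/-- The retraction onto a vertex group. -/
noncomputable def coord (v : V) : GraphProduct Γ G →* G v :=
  (Pi.evalMonoidHom G v).comp (lift (MonoidHom.mulSingle G) fun _ _ h g g' =>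
    commute_mulSingle h.ne g g')

theorem coord_of_self (v : V) (g : G v) : coord v (of (Γ := Γ) v g) = g := by
  classical
  rw [coord, MonoidHom.comp_apply, lift_of]
  simp

theorem coord_of_ne {u v : V} (h : v ≠ u) (g : G u) : coord v (of (Γ := Γ) u g) = 1 := by
  classical
  rw [coord, MonoidHom.comp_apply, lift_of]
  simp [h]

/-- The subgroup generated by the vertex groups of the neighbours of `v`. -/
def link (Γ : SimpleGraph V) (G : V → Type w) [∀ v, Group (G v)] (v : V) :
    Subgroup (GraphProduct Γ G) :=
  Subgroup.closure {y | ∃ u, Γ.Adj u v ∧ ∃ g : G u, y = of u g}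

/-- Consequently the conjugate of `of v g` by `p` depends only on the coset of `p` modulo the link.
-/
theorem commute_of_mem_link {v : V} {y : GraphProduct Γ G} (hy : y ∈ link Γ G v) (g : G v) :
    Commute y (of v g) := by
  have : link Γ G v ≤ Subgroup.centralizer {of v g} := by
    refine (Subgroup.closure_le _).2 ?_
    rintro _ ⟨u, hu, g', rfl⟩
    exact Subgroup.mem_centralizer_singleton_iff.2 (commute_of hu g' g)
  exact Subgroup.mem_centralizer_singleton_iff.1 (this hy)

/-! ### Embedding a graph product in a semidirect product at a vertex -/

section Semidirect

variable (Γ G) (v : V)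

/-- The free product of copies of `G v` indexed by the cosets of the link of `v`, extended by the
action of the graph product. -/
abbrev CosetExtension : Type max u w :=
  CoprodI (fun _ : GraphProduct Γ G ⧸ link Γ G v => G v) ⋊[CoprodI.permute] GraphProduct Γ G

open Classical in
/-- The values on the vertex groups of the splitting of the graph product at `v`. -/
noncomputable def splitOf (u : V) : G u →* CosetExtension Γ G v :=
  if h : u = v then
    (SemidirectProduct.inl.comp (CoprodI.of (M := fun _ : GraphProduct Γ G ⧸ link Γ G v => G v)
      (i := QuotientGroup.mk 1))).comp (h ▸ MonoidHom.id (G u))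
  else SemidirectProduct.inr.comp (of u)

theorem splitOf_self (g : G v) : splitOf Γ G v v g = SemidirectProduct.inl
    (CoprodI.of (M := fun _ : GraphProduct Γ G ⧸ link Γ G v => G v)
      (i := QuotientGroup.mk 1) g) := by
  simp [splitOf]

theorem splitOf_ne {u : V} (h : u ≠ v) (g : G u) :
    splitOf Γ G v u g = SemidirectProduct.inr (of u g) := by
  simp [splitOf, h]

variable {Γ G v} in
-- The link fixes its own coset, so a neighbouring vertex group acts trivially on the copy of `G v`
-- placed there.
theorem commute_splitOf_self {u : V} (h : Γ.Adj u v) (g : G u) (g' : G v) :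
    Commute (splitOf Γ G v u g) (splitOf Γ G v v g') := by
  rw [splitOf_self, splitOf_ne _ _ _ h.ne]
  have hmem : of (Γ := Γ) u g ∈ link Γ G v := Subgroup.subset_closure ⟨u, h, g, rfl⟩
  have hfix : CoprodI.permute (of (Γ := Γ) u g)
      (CoprodI.of (M := fun _ : GraphProduct Γ G ⧸ link Γ G v => G v)
        (i := QuotientGroup.mk 1) g') = CoprodI.of (M := fun _ : GraphProduct Γ G ⧸ link Γ G v =>
        G v) (i := QuotientGroup.mk 1) g' := by
    have : of (Γ := Γ) u g • (QuotientGroup.mk 1 : GraphProduct Γ G ⧸ link Γ G v) =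
        QuotientGroup.mk 1 := by
      rw [MulAction.Quotient.smul_mk, QuotientGroup.eq]
      simpa using hmem
    rw [CoprodI.permute_apply, CoprodI.permuteHom_of, this]
  have := SemidirectProduct.inl_aut (φ := CoprodI.permute) (of (Γ := Γ) u g)
    (CoprodI.of (M := fun _ : GraphProduct Γ G ⧸ link Γ G v => G v) (i := QuotientGroup.mk 1) g')
  rw [hfix, map_inv, eq_mul_inv_iff_mul_eq] at this
  exact this.symm

/-- The graph product splits as a semidirect product at every vertex. -/
noncomputable def split : GraphProduct Γ G →* CosetExtension Γ G v :=
  lift (splitOf Γ G v) fun u u' h g g' => by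
    by_cases hu : u = v
    · subst hu
      exact (commute_splitOf_self h.symm g' g).symm
    · by_cases hu' : u' = v
      · subst hu'
        exact commute_splitOf_self h g g'
      · rw [splitOf_ne _ _ _ hu, splitOf_ne _ _ _ hu']
        exact (commute_of h g g').map SemidirectProduct.inr

/-- The homomorphism sending the copy of `G v` at a coset to a conjugate of `G v`. -/
noncomputable def conjOf :
    CoprodI (fun _ : GraphProduct Γ G ⧸ link Γ G v => G v) →* GraphProduct Γ G :=
  CoprodI.lift fun c => (MulAut.conj c.out).toMonoidHom.comp (of v)

/-- The chosen coset representative is irrelevant because the link commutes with `G v`; equivariance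
in `unsplit` rests on this. -/
theorem conjOf_mk (p : GraphProduct Γ G) (g : G v) :
    conjOf Γ G v (CoprodI.of (M := fun _ : GraphProduct Γ G ⧸ link Γ G v => G v)
      (i := QuotientGroup.mk p) g) = p * of v g * p⁻¹ := by
  obtain ⟨l, hl⟩ := QuotientGroup.mk_out_eq_mul (link Γ G v) p
  have hcomm := commute_of_mem_link l.2 g
  rw [conjOf, CoprodI.lift_of]
  change (QuotientGroup.mk p : GraphProduct Γ G ⧸ link Γ G v).out * of v g *
    (QuotientGroup.mk p : GraphProduct Γ G ⧸ link Γ G v).out⁻¹ = _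
  rw [hl, mul_assoc p, hcomm.eq]
  group

/-- Reassembling the splitting. -/
noncomputable def unsplit : CosetExtension Γ G v →* GraphProduct Γ G :=
  SemidirectProduct.lift (conjOf Γ G v) (MonoidHom.id _) fun p => by
    refine CoprodI.ext_hom _ _ fun c => MonoidHom.ext fun g => ?_
    induction c using QuotientGroup.induction_on with
    | H q =>
      change conjOf Γ G v (CoprodI.permuteHom p (CoprodI.of g)) =
        p * conjOf Γ G v (CoprodI.of g) * p⁻¹
      rw [CoprodI.permuteHom_of, conjOf_mk, MulAction.Quotient.smul_mk, conjOf_mk, smul_eq_mul]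
      group

/-- Only this left inverse is needed: it makes `split` injective. -/
theorem unsplit_split (y : GraphProduct Γ G) : unsplit Γ G v (split Γ G v y) = y := by
  have : (unsplit Γ G v).comp (split Γ G v) = MonoidHom.id _ := by
    refine hom_ext fun u g => ?_
    rw [MonoidHom.comp_apply, split, lift_of, MonoidHom.id_apply, unsplit]
    by_cases hu : u = v
    · subst hu
      rw [splitOf_self, SemidirectProduct.lift_inl, conjOf_mk, one_mul, inv_one, mul_one]
    · rw [splitOf_ne _ _ _ hu, SemidirectProduct.lift_inr, MonoidHom.id_apply]
  exact DFunLike.congr_fun this y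

/-- Together with `fold_split_left`, this translates vanishing under the retraction and under `coord
v` into a trivial right component and a left component in the kernel of `fold`. -/
theorem split_right (y : GraphProduct Γ G) : (split Γ G v y).right = retract {v}ᶜ y := by
  have : SemidirectProduct.rightHom.comp (split Γ G v) = retract {v}ᶜ := by
    refine hom_ext fun u g => ?_
    rw [MonoidHom.comp_apply, split, lift_of]
    by_cases hu : u = v
    · subst hu
      rw [splitOf_self, SemidirectProduct.rightHom_inl, retract_of_notMem (by simp)]
    · rw [splitOf_ne _ _ _ hu, SemidirectProduct.rightHom_inr, retract_of_mem (by simpa using hu)]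
  exact DFunLike.congr_fun this y

theorem fold_split_left (y : GraphProduct Γ G) :
    CoprodI.fold (split Γ G v y).left = coord v y := by
  -- Multiplicativity uses that folding is invariant under permutation of the factors.
  let f : CosetExtension Γ G v →* G v := MonoidHom.mk' (fun z => CoprodI.fold z.left) fun a b => by
    rw [SemidirectProduct.mul_left, map_mul, CoprodI.fold_permute]
  have : f.comp (split Γ G v) = coord v := by
    refine hom_ext fun u g => ?_
    rw [MonoidHom.comp_apply, split, lift_of]
    by_cases hu : u = v
    · subst hu
      rw [splitOf_self, coord_of_self]
      exact CoprodI.fold_of (X := GraphProduct Γ G ⧸ link Γ G u) (QuotientGroup.mk 1) g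
    · rw [splitOf_ne _ _ _ hu, coord_of_ne (Ne.symm hu)]
      exact map_one (CoprodI.fold (X := GraphProduct Γ G ⧸ link Γ G v))
  exact DFunLike.congr_fun this y

end Semidirect

/-! ### Tame retractions and slenderness of graph products -/

variable {C : (H : Type x) → [Group H] → Filter H → Prop}

/-- On this kernel the right component of `split` is trivial, so the left component is an injective
homomorphism into the kernel of `fold`. The latter is slender because `fold` is injective on each
factor. -/
theorem slenderFor_ker_retract_prod_coord (hC : IsTestClass C) (v : V) :
    SlenderFor C ((retract (Γ := Γ) (G := G) {v}ᶜ).prod (coord v)).ker := by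
  have hker : ∀ y ∈ ((retract (Γ := Γ) (G := G) {v}ᶜ).prod (coord v)).ker,
      retract {v}ᶜ y = 1 ∧ coord v y = 1 := fun y hy => Prod.ext_iff.1 hy
  have hfold : SlenderFor C (CoprodI.fold (X := GraphProduct Γ G ⧸ link Γ G v) (G := G v)).ker :=
    CoprodI.slenderFor_ker hC _ fun c g hg => by rwa [CoprodI.fold_of] at hg
  let f : ((retract (Γ := Γ) (G := G) {v}ᶜ).prod (coord v)).ker →*
      (CoprodI.fold (X := GraphProduct Γ G ⧸ link Γ G v) (G := G v)).ker :=
    MonoidHom.mk' (fun y => ⟨(split Γ G v y).left, by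
      rw [MonoidHom.mem_ker, fold_split_left, (hker y y.2).2]⟩) fun a b => Subtype.ext (by
        change (split Γ G v (a * b)).left = (split Γ G v a).left * (split Γ G v b).left
        rw [map_mul, SemidirectProduct.mul_left, split_right, (hker a a.2).1, map_one,
          MulAut.one_apply])
  refine hfold.of_injective f fun a b hab => Subtype.ext ?_
  have hleft : (split Γ G v a).left = (split Γ G v b).left := congrArg Subtype.val hab
  have : split Γ G v a = split Γ G v b :=
    SemidirectProduct.ext hleft (by rw [split_right, split_right, (hker a a.2).1, (hker b b.2).1])
  rw [← unsplit_split Γ G v a, this, unsplit_split]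

theorem coord_retract {v : V} {S : Set V} (hv : v ∈ S) (y : GraphProduct Γ G) :
    coord v (retract S y) = coord v y := by
  have : (coord v).comp (retract S) = coord (Γ := Γ) (G := G) v := by
    refine hom_ext fun u g => ?_
    rw [MonoidHom.comp_apply]
    by_cases hu : u ∈ S
    · rw [retract_of_mem hu]
    · rw [retract_of_notMem hu, map_one, coord_of_ne]
      rintro rfl
      exact hu hv
  exact DFunLike.congr_fun this y

/-- Adding `v` to `F`: the pair of `retract F` and `coord v` is tame, and the new retraction maps
its kernel into the slender kernel of `retract {v}ᶜ` and `coord v`. -/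
theorem tameHom_retract (hC : IsTestClass C) (hG : ∀ v, SlenderFor C (G v)) (F : Finset V) :
    TameHom C (retract (Γ := Γ) (G := G) F) := by
  classical
  induction F using Finset.induction_on with
  | empty =>
    intro H _ N _ φ
    convert univ_mem
    ext y
    simp [MonoidHom.mem_ker, retract_empty]
  | insert v F hv ih =>
    refine TameHom.of_slender_ker hC (ih.prod ((hG v).tameHom (coord v)))
      (slenderFor_ker_retract_prod_coord hC v) fun y hy => ?_
    have hy' : retract (F : Set V) y = 1 ∧ coord v y = 1 := Prod.ext_iff.1 hy
    refine Prod.ext ?_ ?_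
    · change retract {v}ᶜ (retract _ y) = 1
      rw [retract_retract, ← hy'.1]
      congr 2
      ext u
      have : u ∈ F → u ≠ v := fun h => ne_of_mem_of_not_mem h hv
      simp only [Finset.coe_insert, Set.mem_inter_iff, Set.mem_compl_iff, Set.mem_singleton_iff,
        Set.mem_insert_iff, Finset.mem_coe]
      tauto
    · change coord v (retract _ y) = 1
      rw [coord_retract (by simp), hy'.2]

/-- Graph products of slender groups are slender. -/
theorem slenderFor (hC : IsTestClass C) (hG : ∀ v, SlenderFor C (G v)) :
    SlenderFor C (GraphProduct Γ G) :=
  SlenderFor.of_retractions hC retract retract_retract exists_retract_eq (tameHom_retract hC hG)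

end GraphProduct

/-! ### Free products and direct sums -/

section

variable {C : (H : Type x) → [Group H] → Filter H → Prop} {V : Type u} {G : V → Type w}
  [∀ v, Group (G v)]

/-- Free products of slender groups are slender. -/
theorem SlenderFor.coprodI (hC : IsTestClass C) (hG : ∀ v, SlenderFor C (G v)) :
    SlenderFor C (Monoid.CoprodI G) := by
  refine (GraphProduct.slenderFor (Γ := ⊥) hC hG).of_injective (QuotientGroup.mk' _) ?_
  rw [← MonoidHom.ker_eq_bot_iff, QuotientGroup.ker_mk', eq_bot_iff]
  -- The edgeless graph imposes no relations.
  refine Subgroup.normalClosure_le_normal ?_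
  rintro _ ⟨v, v', g, g', h, -⟩
  exact h.elim

open Classical in
/-- The restriction of the support of an element of a direct sum to a set of indices. -/
noncomputable def directSumRestrict (S : Set V) : directSumSubgroup G →* directSumSubgroup G where
  toFun y := ⟨fun v => if v ∈ S then y.1 v else 1, Set.Finite.subset y.2 fun v hv => by
    by_contra h
    have h' : y.1 v = 1 := not_not.1 h
    exact hv (by simp [h'])⟩
  map_one' := Subtype.ext (funext fun v => by simp)
  map_mul' a b := Subtype.ext (funext fun v => by by_cases h : v ∈ S <;> simp [h])

theorem directSumRestrict_apply (S : Set V) (y : directSumSubgroup G) (v : V) [Decidable (v ∈ S)] :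
    (directSumRestrict S y).1 v = if v ∈ S then y.1 v else 1 := by
  simp only [directSumRestrict, MonoidHom.coe_mk, OneHom.coe_mk]
  congr

/-- Direct sums of slender groups are slender. -/
theorem SlenderFor.directSum (hC : IsTestClass C) (hG : ∀ v, SlenderFor C (G v)) :
    SlenderFor C (directSumSubgroup G) := by
  classical
  refine SlenderFor.of_retractions hC directSumRestrict (fun S T y => ?_) (fun y => ?_) fun F => ?_
  · refine Subtype.ext (funext fun v => ?_)
    simp only [directSumRestrict_apply, Set.mem_inter_iff]
    by_cases hS : v ∈ S <;> by_cases hT : v ∈ T <;> simp [hS, hT]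
  · refine ⟨Set.Finite.toFinset y.2, Subtype.ext (funext fun v => ?_)⟩
    rw [directSumRestrict_apply]
    by_cases hv : y.1 v = 1
    · rw [hv, ite_self]
    · exact if_pos (Finset.mem_coe.2 ((Set.Finite.mem_toFinset _).2 hv))
  · intro H _ N hN φ
    -- The projections `.1.1.1` unwrap the kernel to its carrier set. A restriction to finitely many
    -- indices is trivial as soon as those finitely many coordinates are.
    have hmem : ∀ v, (((Pi.evalMonoidHom G v).comp (directSumSubgroup G).subtype).comp φ).ker.1.1.1
        ∈ N := fun v => hG v H N hN _
    refine mem_of_superset ((biInter_finset_mem F).2 fun v _ => hmem v) fun y hy => ?_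
    refine Subtype.ext (funext fun v => ?_)
    change (directSumRestrict _ (φ y)).1 v = 1
    rw [directSumRestrict_apply]
    split_ifs with hv
    · exact Set.mem_iInter₂.1 hy v hv
    · rfl

end

/-! ### Infinite products in topological groups -/

open Topology

section IteratedProduct

variable {H : Type x} [Group H]

/-- If `l` is the history of `g` at time `m`, this is `y ↦ gₙ (gₙ₊₁ (⋯ gₘ₋₁ y ^ kₘ ⋯) ^ kₙ₊₂) ^ kₙ₊₁`
for `n ≤ m`, and `y` for `m ≤ n`. -/
def iteratedProduct (k : List H → ℕ) : List H → ℕ → H → H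
  | [], _, y => y
  | g :: l, n, y => if n ≤ l.length then iteratedProduct k l n (g * y ^ k (g :: l)) else y

theorem iteratedProduct_of_length_le (k : List H → ℕ) {l : List H} {n : ℕ} (h : l.length ≤ n)
    (y : H) : iteratedProduct k l n y = y := by
  cases l with
  | nil => rfl
  | cons g l =>
    rw [List.length_cons] at h
    rw [iteratedProduct, if_neg (by omega)]

theorem iteratedProduct_history_succ (k : List H → ℕ) (g : ℕ → H) {n m : ℕ} (h : n ≤ m) (y : H) :
    iteratedProduct k (history g (m + 1)) n y =
      iteratedProduct k (history g m) n (g m * y ^ k (history g (m + 1))) := by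
  rw [history, iteratedProduct, length_history, if_pos h]

/-- The definition absorbs the newest factor into the argument; this expansion from the outer end is
the equation that survives in the limit. -/
theorem iteratedProduct_history (k : List H → ℕ) (g : ℕ → H) {n m : ℕ} (h : n < m) :
    ∀ y, iteratedProduct k (history g m) n y =
      g n * iteratedProduct k (history g m) (n + 1) y ^ k (history g (n + 1)) := by
  induction m with
  | zero => omega
  | succ m ih =>
    intro y
    rw [iteratedProduct_history_succ k g (by omega)]
    by_cases hnm : n = m
    · subst hnm
      rw [iteratedProduct_of_length_le k (length_history g n).le,
        iteratedProduct_of_length_le k (length_history g (n + 1)).le]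
    · rw [ih (by omega), iteratedProduct_history_succ k g (by omega)]

/-- Histories list recent terms first, so dropping recovers earlier ones. Conditions imposed at time
`m` can thus refer to the history at time `n`. -/
theorem drop_history {α : Type*} (g : ℕ → α) {n m : ℕ} (h : n ≤ m) :
    (history g m).drop ((history g m).length - n) = history g n := by
  rw [length_history]
  induction m with
  | zero => obtain rfl := Nat.le_zero.1 h; rfl
  | succ m ih =>
    by_cases hnm : n = m + 1
    · subst hnm; simp
    · rw [Nat.succ_sub (by omega), history, List.drop_succ_cons, ih (by omega)]

variable [TopologicalSpace H] [IsTopologicalGroup H]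

theorem continuous_iteratedProduct (k : List H → ℕ) (l : List H) (n : ℕ) :
    Continuous (iteratedProduct k l n) := by
  induction l with
  | nil => exact continuous_id
  | cons g l ih =>
    by_cases h : n ≤ l.length
    · have : iteratedProduct k (g :: l) n =
          fun y => iteratedProduct k l n (g * y ^ k (g :: l)) := by
        funext y; rw [iteratedProduct, if_pos h]
      rw [this]
      exact ih.comp (continuous_const.mul (continuous_pow _))
    · have : iteratedProduct k (g :: l) n = id := by
        funext y; rw [iteratedProduct, if_neg h]; rfl
      rw [this]
      exact continuous_id

/-- A new factor `a` changes each partial product from its value at `1` to its value at `a`. By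
continuity, finitely many such changes are small at once. -/
theorem exists_sequence_iteratedProduct {A : Set H} (hA : ∀ U ∈ 𝓝 (1 : H), (A ∩ U).Nonempty)
    (k : List H → ℕ) {T : List H → ℕ → Set H}
    (hT : ∀ l n, T l n ∈ 𝓝 (iteratedProduct k l n 1)) :
    ∃ g : ℕ → H, ∀ m, g m ∈ A ∧ ∀ n ≤ m,
      iteratedProduct k (history g (m + 1)) n 1 ∈ T (history g m) n := by
  obtain ⟨g, hg⟩ := exists_sequence_of_history
    (p := fun l a => a ∈ A ∧ ∀ n ≤ l.length, iteratedProduct k l n a ∈ T l n) fun l => by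
      obtain ⟨a, ha, ha'⟩ := hA (⋂ n ∈ Finset.Iic l.length, iteratedProduct k l n ⁻¹' T l n)
        ((biInter_finset_mem _).2 fun n _ =>
          (continuous_iteratedProduct k l n).continuousAt.preimage_mem_nhds (hT l n))
      exact ⟨a, ha, fun n hn => Set.mem_iInter₂.1 ha' n (Finset.mem_Iic.2 hn)⟩
  refine ⟨g, fun m => ⟨(hg m).1, fun n hn => ?_⟩⟩
  rw [iteratedProduct_history_succ k g hn, one_pow, mul_one]
  exact (hg m).2 n (by rwa [length_history])

theorem exists_sequence_iteratedProduct_mem {A : Set H}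
    (hA : ∀ U ∈ 𝓝 (1 : H), (A ∩ U).Nonempty) {V : List H → Subgroup H}
    (hV : ∀ l, (V l : Set H) ∈ 𝓝 1) (k : List H → ℕ) {O : Set H} (hO : IsOpen O)
    (hO_one : (1 : H) ∈ O) {D : List H → ℕ → Set H}
    (hD : ∀ l n, D l n ∈ 𝓝 (iteratedProduct k l n 1)) :
    ∃ g : ℕ → H, ∀ m, g m ∈ A ∧ ∀ n ≤ m,
      iteratedProduct k (history g m) n 1 ∈ V (history g n) ∧
      iteratedProduct k (history g m) n 1 ∈ O ∧
      iteratedProduct k (history g (m + 1)) n 1 ∈ D (history g m) n := by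
  classical
  let W : List H → Set H := fun l => V l ∩ O
  have hW : ∀ l, IsOpen (W l) := fun l => ((V l).isOpen_of_mem_nhds (hV l)).inter hO
  let E : List H → ℕ → Set H := fun l n => W (l.drop (l.length - n))
  obtain ⟨g, hg⟩ := exists_sequence_iteratedProduct hA k
    -- The neighbourhoods must be given for all lists, whereas membership in `E l n` is known only
    -- along the sequence built. The conditional preserves membership once it holds, and it holds
    -- initially for the empty product `1`.
    (T := fun l n => D l n ∩ if iteratedProduct k l n 1 ∈ E l n then E l n else Set.univ)
    fun l n => inter_mem (hD l n) (by
      split_ifs with h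
      · exact (hW _).mem_nhds h
      · exact univ_mem)
  have hmem : ∀ n m, n ≤ m → iteratedProduct k (history g m) n 1 ∈ W (history g n) := by
    intro n m hnm
    induction m, hnm using Nat.le_induction with
    | base =>
      rw [iteratedProduct_of_length_le k (length_history g n).le]
      exact ⟨one_mem _, hO_one⟩
    | succ m hnm ih =>
      have h := ((hg m).2 n hnm).2
      have hE : E (history g m) n = W (history g n) := by
        simp only [E, drop_history g hnm]
      rwa [if_pos (hE ▸ ih), hE] at h
  exact ⟨g, fun m => ⟨(hg m).1, fun n hn => ⟨(hmem n m hn).1, (hmem n m hn).2,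
    ((hg m).2 n hn).1⟩⟩⟩

/-- Open subgroups are closed, so membership passes to the limit; the equation does so by continuity
and uniqueness of limits. The filter `L` is general, to allow limits along an ultrafilter. -/
theorem infinite_product_of_tendsto [T2Space H] (k : List H → ℕ) {V : List H → Subgroup H}
    (hV : ∀ l, (V l : Set H) ∈ 𝓝 1) {g h : ℕ → H}
    (hg : ∀ n m, n ≤ m → iteratedProduct k (history g m) n 1 ∈ V (history g n))
    {L : Filter ℕ} [L.NeBot] (hL : L ≤ atTop)
    (hlim : ∀ n, Tendsto (fun m => iteratedProduct k (history g m) n 1) L (𝓝 (h n))) (n : ℕ) :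
    h n ∈ V (history g n) ∧ h n = g n * h (n + 1) ^ k (history g (n + 1)) := by
  constructor
  · have hclosed : IsClosed (V (history g n) : Set H) :=
      (V (history g n)).isClosed_of_isOpen ((V (history g n)).isOpen_of_mem_nhds (hV _))
    exact hclosed.mem_of_tendsto (hlim n) (hL ((eventually_ge_atTop n).mono fun m hm => hg n m hm))
  · refine tendsto_nhds_unique (hlim n) ?_
    refine (((hlim (n + 1)).pow (k (history g (n + 1)))).const_mul (g n)).congr' ?_
    exact hL ((eventually_gt_atTop n).mono fun m hm => (iteratedProduct_history k g hm 1).symm)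

theorem hasInfiniteProducts_of_isCompletelyMetrizableSpace
    [TopologicalSpace.IsCompletelyMetrizableSpace H] : HasInfiniteProducts H (𝓝 1) := by
  intro A hA V hV k
  let _ := TopologicalSpace.upgradeIsCompletelyMetrizable H
  obtain ⟨g, hg⟩ := exists_sequence_iteratedProduct_mem hA hV k isOpen_univ (Set.mem_univ 1)
    -- The complete metric need not be invariant, so geometric smallness is imposed on the partial
    -- products and not on the factors.
    (D := fun l n => Metric.ball (iteratedProduct k l n 1) (1 * (1 / 2) ^ l.length))
    fun l n => Metric.ball_mem_nhds _ (by positivity)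
  have hcauchy : ∀ n, CauchySeq fun m => iteratedProduct k (history g m) n 1 := fun n => by
    refine cauchySeq_of_le_geometric (1 / 2) 1 (by norm_num) fun m => ?_
    by_cases hnm : n ≤ m
    · have := ((hg m).2 n hnm).2.2
      rw [Metric.mem_ball, length_history, dist_comm] at this
      exact this.le
    · rw [iteratedProduct_of_length_le k (by rw [length_history]; omega),
        iteratedProduct_of_length_le k (by rw [length_history]; omega), dist_self]
      positivity
  choose h hh using fun n => cauchySeq_tendsto_of_complete (hcauchy n)
  exact ⟨g, h, fun n => ⟨(hg n).1,
    infinite_product_of_tendsto k hV (fun n m hnm => ((hg m).2 n hnm).1) le_rfl hh n⟩⟩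

theorem hasInfiniteProducts_of_locallyCompactSpace [LocallyCompactSpace H] [T2Space H] :
    HasInfiniteProducts H (𝓝 1) := by
  intro A hA V hV k
  obtain ⟨K, hK, hK_one⟩ := exists_compact_mem_nhds (1 : H)
  obtain ⟨g, hg⟩ := exists_sequence_iteratedProduct_mem hA hV k isOpen_interior
    (mem_interior_iff_mem_nhds.2 hK_one) (D := fun _ _ => Set.univ) fun _ _ => univ_mem
  -- The partial products stay in the compact set `K`. One ultrafilter serves all `n`, which keeps
  -- the limits compatible.
  have hlim : ∀ n, ∃ y, Tendsto (fun m => iteratedProduct k (history g m) n 1)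
      (hyperfilter ℕ : Filter ℕ) (𝓝 y) := fun n => by
    obtain ⟨y, -, hy⟩ := hK.ultrafilter_le_nhds
      ((hyperfilter ℕ).map fun m => iteratedProduct k (history g m) n 1) (by
        rw [le_principal_iff]
        exact Nat.hyperfilter_le_atTop ((eventually_ge_atTop n).mono fun m hm =>
          interior_subset ((hg m).2 n hm).2.1))
    exact ⟨y, hy⟩
  choose h hh using hlim
  exact ⟨g, h, fun n => ⟨(hg n).1, infinite_product_of_tendsto k hV
    (fun n m hnm => ((hg m).2 n hnm).1) Nat.hyperfilter_le_atTop hh n⟩⟩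

end IteratedProduct

/-! ### The topological test classes -/

/-- The completely metrizable groups with their neighbourhoods of `1`. -/
def CompletelyMetrizableTest (H : Type x) [Group H] (N : Filter H) : Prop :=
  ∃ _ : TopologicalSpace H, IsTopologicalGroup H ∧
    TopologicalSpace.IsCompletelyMetrizableSpace H ∧ N = 𝓝 1

/-- The locally compact Hausdorff groups with their neighbourhoods of `1`. -/
def LocallyCompactTest (H : Type x) [Group H] (N : Filter H) : Prop :=
  ∃ _ : TopologicalSpace H, IsTopologicalGroup H ∧ LocallyCompactSpace H ∧ T2Space H ∧ N = 𝓝 1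

theorem isTestClass_completelyMetrizableTest : IsTestClass CompletelyMetrizableTest.{x} where
  hasInfiniteProducts := by
    rintro H _ N ⟨_, _, _, rfl⟩
    exact hasInfiniteProducts_of_isCompletelyMetrizableSpace
  restrict := by
    rintro H _ N ⟨_, _, _, rfl⟩ U hU
    have hopen := U.isOpen_of_mem_nhds hU
    refine ⟨U, inferInstance, 𝓝 1, U.subtype, ⟨inferInstance, inferInstance,
      (U.isClosed_of_isOpen hopen).isCompletelyMetrizableSpace, rfl⟩, fun y => y.2, ?_⟩
    exact hopen.isOpenMap_subtype_val.nhds_le 1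

theorem isTestClass_locallyCompactTest : IsTestClass LocallyCompactTest.{x} where
  hasInfiniteProducts := by
    rintro H _ N ⟨_, _, _, _, rfl⟩
    exact hasInfiniteProducts_of_locallyCompactSpace
  restrict := by
    rintro H _ N ⟨_, _, _, _, rfl⟩ U hU
    have hopen := U.isOpen_of_mem_nhds hU
    refine ⟨U, inferInstance, 𝓝 1, U.subtype, ⟨inferInstance, inferInstance,
      hopen.locallyCompactSpace, inferInstance, rfl⟩, fun y => y.2, ?_⟩
    exact hopen.isOpenMap_subtype_val.nhds_le 1

theorem cmSlender_iff {G : Type w} [Group G] :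
    CmSlender.{w, x} G ↔ SlenderFor CompletelyMetrizableTest.{x} G := by
  constructor
  · rintro h H _ N ⟨_, _, _, rfl⟩ φ
    exact (h H φ).mem_nhds (one_mem φ.ker)
  · intro h H _ _ _ _ φ
    exact φ.ker.isOpen_of_mem_nhds (h H (𝓝 1) ⟨_, inferInstance, inferInstance, rfl⟩ φ)

theorem lcHSlender_iff {G : Type w} [Group G] :
    LcHSlender.{w, x} G ↔ SlenderFor LocallyCompactTest.{x} G := by
  constructor
  · rintro h H _ N ⟨_, _, _, _, rfl⟩ φ
    exact (h H φ).mem_nhds (one_mem φ.ker)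
  · intro h H _ _ _ _ _ φ
    exact φ.ker.isOpen_of_mem_nhds
      (h H (𝓝 1) ⟨_, inferInstance, inferInstance, inferInstance, rfl⟩ φ)

/-! ### Infinite products in the Hawaiian earring group -/

namespace EarringWord

theorem toFree_eq_of_orderIso {W₁ W₂ : EarringWord} (e : W₁.Carrier ≃o W₂.Carrier)
    (he : ∀ i, W₂.letter (e i) = W₁.letter i) (N : ℕ) : toFree N W₁ = toFree N W₂ := by
  have : W₂.positions N = (W₁.positions N).map e := by
    refine positions_eq (List.pairwise_map.2 ((W₁.pairwise_positions N).imp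
      fun h => e.lt_iff_lt.2 h)) fun i => ?_
    rw [List.mem_map]
    constructor
    · rintro ⟨j, hj, rfl⟩
      rw [he]
      exact mem_positions.1 hj
    · intro hi
      exact ⟨e.symm i, mem_positions.2 (by rwa [← he, e.apply_symm_apply]), e.apply_symm_apply i⟩
  rw [toFree, toFree, this, List.map_map]
  exact congrArg _ (List.map_congr_left fun i _ => (he i).symm)

theorem positions_eq_nil {W : EarringWord} {N : ℕ} (h : ∀ i, N ≤ (W.letter i).1) :
    W.positions N = [] :=
  positions_eq List.Pairwise.nil fun i => by simpa using h i

/-- Increase the indices of all letters by `n`. -/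
def shift (n : ℕ) (W : EarringWord) : EarringWord where
  Carrier := W.Carrier
  letter i := ((W.letter i).1 + n, (W.letter i).2)
  finite_lt N := (W.finite_lt N).subset fun _ hi => lt_of_le_of_lt (Nat.le_add_right _ n) hi

theorem toFree_shift (N n : ℕ) (W : EarringWord) :
    toFree N (W.shift n) = FreeGroup.map (· + n) (toFree (N - n) W) := by
  have : (W.shift n).positions N = W.positions (N - n) :=
    positions_eq (W.pairwise_positions (N - n)) fun i =>
      (mem_positions (W := W) (i := i)).trans Nat.lt_sub_iff_add_lt
  rw [toFree, this, toFree, FreeGroup.map.mk, List.map_map]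
  rfl

/-- Decrease the indices of all letters by `n`. -/
def unshift (n : ℕ) (W : EarringWord) : EarringWord where
  Carrier := W.Carrier
  letter i := ((W.letter i).1 - n, (W.letter i).2)
  finite_lt N := (W.finite_lt (N + n)).subset fun i hi => by
    have hi' : (W.letter i).1 - n < N := hi
    change (W.letter i).1 < N + n
    omega

theorem toFree_shift_unshift {n : ℕ} {W : EarringWord} (h : ∀ i, n ≤ (W.letter i).1) (N : ℕ) :
    toFree N ((W.unshift n).shift n) = toFree N W :=
  toFree_eq_of_orderIso (W₁ := (W.unshift n).shift n) (OrderIso.refl W.Carrier)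
    (fun i => Prod.ext (Nat.sub_add_cancel (h i)).symm rfl) N

/-- The restriction of a word to a set of positions. -/
def restrict (W : EarringWord) (S : Set W.Carrier) : EarringWord where
  Carrier := {i // i ∈ S}
  letter i := W.letter i.1
  finite_lt N := (W.finite_lt N).preimage Subtype.val_injective.injOn

/-- The position in `W` of a position in a restriction of `W`. -/
def ofRestrict {W : EarringWord} {S : Set W.Carrier} (i : (W.restrict S).Carrier) : W.Carrier :=
  Subtype.val (p := (· ∈ S)) i

theorem positions_eq_append {W : EarringWord} {S : Set W.Carrier} (hS : IsLowerSet S) (N : ℕ) :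
    W.positions N = ((W.restrict S).positions N).map ofRestrict ++
      ((W.restrict Sᶜ).positions N).map ofRestrict := by
  refine positions_eq (List.pairwise_append.2 ⟨?_, ?_, ?_⟩) fun i => ?_
  · exact List.pairwise_map.2 (((W.restrict S).pairwise_positions N).imp fun h => h)
  · exact List.pairwise_map.2 (((W.restrict Sᶜ).pairwise_positions N).imp fun h => h)
  · intro a ha b hb
    obtain ⟨i, -, rfl⟩ := List.mem_map.1 ha
    obtain ⟨j, -, rfl⟩ := List.mem_map.1 hb
    exact lt_of_not_ge fun hji => j.2 (hS hji i.2)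
  · rw [List.mem_append, List.mem_map, List.mem_map]
    constructor
    · rintro (⟨j, hj, rfl⟩ | ⟨j, hj, rfl⟩) <;>
        · have h := mem_positions.1 hj
          exact h
    · intro hi
      by_cases hiS : i ∈ S
      · exact Or.inl ⟨⟨i, hiS⟩, mem_positions.2 hi, rfl⟩
      · exact Or.inr ⟨⟨i, hiS⟩, mem_positions.2 hi, rfl⟩

theorem length_positions_eq_add {W : EarringWord} {S : Set W.Carrier} (hS : IsLowerSet S)
    (N : ℕ) : (W.positions N).length =
      ((W.restrict S).positions N).length + ((W.restrict Sᶜ).positions N).length := by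
  rw [positions_eq_append hS, List.length_append, List.length_map, List.length_map]

theorem toFree_eq_mul {W : EarringWord} {S : Set W.Carrier} (hS : IsLowerSet S) (N : ℕ) :
    toFree N W = toFree N (W.restrict S) * toFree N (W.restrict Sᶜ) := by
  rw [toFree, positions_eq_append hS, List.map_append, List.map_map, List.map_map,
    ← FreeGroup.mul_mk]
  rfl

/-! ### Solving the recursive equations by nested words -/

/-- The positions of the solution of the equations `hₙ = Wₙ * hₙ₊₁ ^ kₙ`. -/
inductive NestedPosition (W : ℕ → EarringWord) (k : ℕ → ℕ) : ℕ → Type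
  | head {n : ℕ} (p : (W n).Carrier) : NestedPosition W k n
  -- The index `j` selects one of the `k n` copies of the next solution; every position lies at
  -- finite depth.
  | step {n : ℕ} (j : Fin (k n)) (q : NestedPosition W k (n + 1)) : NestedPosition W k n

namespace NestedPosition

variable {W : ℕ → EarringWord} {k : ℕ → ℕ}

/-- The order on the positions. -/
def Before : ∀ {n : ℕ}, NestedPosition W k n → NestedPosition W k n → Prop
  | _, head p, head p' => p < p'
  | _, head _, step _ _ => True
  | _, step _ _, head _ => False
  | _, step j q, step j' q' => j < j' ∨ j = j' ∧ Before q q'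

theorem not_before_self {n : ℕ} (p : NestedPosition W k n) : ¬ Before p p := by
  induction p with
  | head p => exact lt_irrefl p
  | step j q ih =>
    rintro (h | ⟨-, h⟩)
    · exact lt_irrefl j h
    · exact ih h

theorem before_trans {n : ℕ} (a b c : NestedPosition W k n) (hab : Before a b)
    (hbc : Before b c) : Before a c := by
  induction a with
  | head p =>
    cases c with
    | head p'' =>
      cases b with
      | head p' => exact lt_trans (show p < p' from hab) hbc
      | step j' q' => exact hbc.elim
    | step j'' q'' => trivial
  | step j q ih =>
    cases b with
    | head p' => exact hab.elim
    | step j' q' =>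
      cases c with
      | head p'' => exact hbc.elim
      | step j'' q'' =>
        rcases hab with h | ⟨rfl, h⟩
        · rcases hbc with h' | ⟨rfl, -⟩
          · exact Or.inl (h.trans h')
          · exact Or.inl h
        · rcases hbc with h' | ⟨rfl, h'⟩
          · exact Or.inl h'
          · exact Or.inr ⟨rfl, ih _ _ h h'⟩

theorem before_trichotomous {n : ℕ} (a b : NestedPosition W k n) :
    Before a b ∨ a = b ∨ Before b a := by
  induction a with
  | head p =>
    cases b with
    | head p' =>
      rcases lt_trichotomy p p' with h | rfl | h
      · exact Or.inl h
      · exact Or.inr (Or.inl rfl)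
      · exact Or.inr (Or.inr h)
    | step j' q' => exact Or.inl trivial
  | step j q ih =>
    cases b with
    | head p' => exact Or.inr (Or.inr trivial)
    | step j' q' =>
      rcases lt_trichotomy j j' with h | rfl | h
      · exact Or.inl (Or.inl h)
      · rcases ih q' with h | rfl | h
        · exact Or.inl (Or.inr ⟨rfl, h⟩)
        · exact Or.inr (Or.inl rfl)
        · exact Or.inr (Or.inr (Or.inr ⟨rfl, h⟩))
      · exact Or.inr (Or.inr (Or.inl h))

open Classical in
noncomputable instance {n : ℕ} : LinearOrder (NestedPosition W k n) where
  le a b := a = b ∨ Before a b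
  lt := Before
  le_refl a := Or.inl rfl
  le_trans a b c hab hbc := by
    rcases hab with rfl | hab
    · exact hbc
    · rcases hbc with rfl | hbc
      · exact Or.inr hab
      · exact Or.inr (before_trans _ _ _ hab hbc)
  lt_iff_le_not_ge a b := by
    constructor
    · refine fun h => ⟨Or.inr h, ?_⟩
      rintro (rfl | h')
      · exact not_before_self _ h
      · exact not_before_self _ (before_trans _ _ _ h h')
    · rintro ⟨rfl | h, h'⟩
      · exact (h' (Or.inl rfl)).elim
      · exact h
  le_antisymm a b hab hba := by
    rcases hab with h | h
    · exact h
    · rcases hba with h' | h'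
      · exact h'.symm
      · exact (not_before_self _ (before_trans _ _ _ h h')).elim
  le_total a b := by
    rcases before_trichotomous a b with h | h | h
    · exact Or.inl (Or.inr h)
    · exact Or.inl (Or.inl h)
    · exact Or.inr (Or.inr h)
  toDecidableLE := Classical.decRel _

/-- The path from the root to a position, together with the position in the word at its end. -/
def code : ∀ {n : ℕ}, NestedPosition W k n → List ℕ × (Σ m, (W m).Carrier)
  | n, head p => ([], ⟨n, p⟩)
  | _, step j q => (j.1 :: (code q).1, (code q).2)

/-- Countability of the positions follows, since codes lie in a countable type. -/
theorem code_injective {n : ℕ} : Function.Injective (code (W := W) (k := k) (n := n)) := by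
  intro a b h
  induction a with
  | head p =>
    cases b with
    | head p' => simpa [code] using h
    | step j' q' => simp [code] at h
  | step j q ih =>
    cases b with
    | head p' => simp [code] at h
    | step j' q' =>
      simp only [code, Prod.mk.injEq, List.cons.injEq] at h
      rw [Fin.ext h.1.1, ih (Prod.ext h.1.2 h.2)]

instance {n : ℕ} : Countable (NestedPosition W k n) := code_injective.countable

/-- The letter at a position. -/
def letter : ∀ {n : ℕ}, NestedPosition W k n → ℕ × Bool
  | n, head p => (W n).letter p
  | _, step _ q => letter q

theorem le_letter {M n : ℕ} (hM : ∀ m, n ≤ m → ∀ i, M ≤ ((W m).letter i).1)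
    (p : NestedPosition W k n) : M ≤ (letter p).1 := by
  induction p with
  | head p => exact hM _ le_rfl p
  | step j q ih => exact ih fun m hm => hM m (by omega)

/-- Downward induction on the level: from level `N` on, no letter has index below `N`, and an
earlier level adds finitely many positions to finitely many copies of the next. -/
theorem finite_letter_lt (hW : ∀ m i, m ≤ ((W m).letter i).1) (N : ℕ) (d : ℕ) :
    ∀ n, N ≤ n + d → {p : NestedPosition W k n | (letter p).1 < N}.Finite := by
  induction d with
  | zero =>
    intro n hn
    convert Set.finite_empty
    refine Set.eq_empty_of_forall_notMem fun p hp => ?_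
    have h₁ := le_letter (M := n) (fun m hm i => hm.trans (hW m i)) p
    have h₂ : (letter p).1 < N := hp
    omega
  | succ d ih =>
    intro n hn
    refine ((((W n).finite_lt N).image head).union
      ((Set.finite_univ.prod (ih (n + 1) (by omega))).image
        fun y : Fin (k n) × NestedPosition W k (n + 1) => step y.1 y.2)).subset fun p hp => ?_
    cases p with
    | head p => exact Or.inl ⟨p, hp, rfl⟩
    | step j q => exact Or.inr ⟨(j, q), ⟨Set.mem_univ _, hp⟩, rfl⟩

end NestedPosition

/-- The solution of the equations `hₙ = Wₙ * hₙ₊₁ ^ kₙ`. -/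
noncomputable def nested (W : ℕ → EarringWord) (k : ℕ → ℕ) (hW : ∀ m i, m ≤ ((W m).letter i).1)
    (n : ℕ) : EarringWord where
  Carrier := NestedPosition W k n
  letter := NestedPosition.letter
  finite_lt N := NestedPosition.finite_letter_lt hW N N n (by omega)

theorem freeGroup_mk_flatMap_const {α β : Type*} (l : List α) (L : List (β × Bool)) :
    FreeGroup.mk (l.flatMap fun _ => L) = FreeGroup.mk L ^ l.length := by
  induction l with
  | nil => rfl
  | cons a l ih =>
    rw [List.flatMap_cons, ← FreeGroup.mul_mk, ih, List.length_cons, pow_succ']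

/-- The positions at level `n` are those of `W n` followed by `k n` successive copies of level `n +
1`. -/
theorem toFree_nested {W : ℕ → EarringWord} {k : ℕ → ℕ} (hW : ∀ m i, m ≤ ((W m).letter i).1)
    (N n : ℕ) : toFree N (nested W k hW n) =
      toFree N (W n) * toFree N (nested W k hW (n + 1)) ^ k n := by
  let f : Fin (k n) → (nested W k hW (n + 1)).Carrier → (nested W k hW n).Carrier :=
    fun j q => NestedPosition.step j q
  let e : (W n).Carrier → (nested W k hW n).Carrier := fun p => NestedPosition.head p
  have : (nested W k hW n).positions N = ((W n).positions N).map e ++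
      (List.finRange (k n)).flatMap fun j => ((nested W k hW (n + 1)).positions N).map (f j) := by
    refine positions_eq (List.pairwise_append.2 ⟨?_, ?_, ?_⟩) fun i => ?_
    · exact List.pairwise_map.2 (((W n).pairwise_positions N).imp fun h => h)
    · refine List.pairwise_flatMap.2 ⟨fun j _ => List.pairwise_map.2
        (((nested W k hW (n + 1)).pairwise_positions N).imp fun h => Or.inr ⟨rfl, h⟩), ?_⟩
      refine (List.sortedLT_finRange (k n)).pairwise.imp fun {j j'} hj => ?_
      intro a ha b hb
      obtain ⟨q, -, rfl⟩ := List.mem_map.1 ha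
      obtain ⟨q', -, rfl⟩ := List.mem_map.1 hb
      exact Or.inl hj
    · intro a ha b hb
      obtain ⟨p, -, rfl⟩ := List.mem_map.1 ha
      obtain ⟨j, -, hb⟩ := List.mem_flatMap.1 hb
      obtain ⟨q, -, rfl⟩ := List.mem_map.1 hb
      exact trivial
    · rw [List.mem_append, List.mem_map, List.mem_flatMap]
      constructor
      · rintro (⟨p, hp, rfl⟩ | ⟨j, -, h⟩)
        · have h := mem_positions.1 hp
          exact h
        · obtain ⟨q, hq, rfl⟩ := List.mem_map.1 h
          have h := mem_positions.1 hq
          exact h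
      · intro hi
        cases i using NestedPosition.casesOn with
        | head p => exact Or.inl ⟨p, mem_positions.2 hi, rfl⟩
        | step j q =>
          exact Or.inr ⟨j, List.mem_finRange j, List.mem_map.2 ⟨q, mem_positions.2 hi, rfl⟩⟩
  rw [toFree, this, List.map_append, ← FreeGroup.mul_mk, List.map_map, List.map_flatMap]
  congr 1
  simp only [List.map_map]
  refine (freeGroup_mk_flatMap_const (List.finRange (k n))
    (((nested W k hW (n + 1)).positions N).map (nested W k hW (n + 1)).letter)).trans ?_
  rw [List.length_finRange]
  rfl

end EarringWord

/-! ### Tails of the Hawaiian earring group -/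

namespace EarringGroup

open EarringWord

theorem mk_eq_mk {W₁ W₂ : EarringWord} (h : ∀ N, toFree N W₁ = toFree N W₂) : mk W₁ = mk W₂ :=
  Quotient.sound h

/-- The subgroup of the classes of words in the letters of index at least `N`. -/
def tail (N : ℕ) : Subgroup EarringGroup where
  carrier := {y | ∃ W : EarringWord, (∀ i, N ≤ (W.letter i).1) ∧ mk W = y}
  one_mem' := ⟨empty, fun i => i.elim, rfl⟩
  mul_mem' := by
    rintro _ _ ⟨W₁, h₁, rfl⟩ ⟨W₂, h₂, rfl⟩
    refine ⟨W₁.concat W₂, fun i => ?_, rfl⟩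
    have key : ∀ j : W₁.Carrier ⊕ W₂.Carrier, N ≤ (Sum.elim W₁.letter W₂.letter j).1 := by
      rintro (j | j)
      · exact h₁ j
      · exact h₂ j
    exact key (ofLex (i : W₁.Carrier ⊕ₗ W₂.Carrier))
  inv_mem' := by
    rintro _ ⟨W, h, rfl⟩
    exact ⟨W.reverse, fun i => h (OrderDual.ofDual (i : W.Carrierᵒᵈ)), rfl⟩

theorem tail_antitone : Antitone tail := by
  rintro M N hMN _ ⟨W, hW, rfl⟩
  exact ⟨W, fun i => hMN.trans (hW i), rfl⟩

theorem retraction_eq_one {N : ℕ} {y : EarringGroup} (hy : y ∈ tail N) : retraction N y = 1 := by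
  obtain ⟨W, hW, rfl⟩ := hy
  refine mk_eq_mk fun M => ?_
  rw [toFree_truncate, toFree_empty, toFree,
    positions_eq_nil fun i => (min_le_right M N).trans (hW i)]
  rfl

theorem retraction_mk_eq_self {N : ℕ} {W : EarringWord} (hW : ∀ i, (W.letter i).1 < N) :
    retraction N (mk W) = mk W := by
  refine mk_eq_mk fun M => ?_
  have : W.positions (min M N) = W.positions M :=
    positions_eq (W.pairwise_positions M) fun i => by
      rw [mem_positions, lt_min_iff, and_iff_left (hW i)]
  rw [toFree_truncate, toFree, this, toFree]

theorem mk_eq_mul {W : EarringWord} {S : Set W.Carrier} (hS : IsLowerSet S) :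
    mk W = mk (W.restrict S) * mk (W.restrict Sᶜ) :=
  mk_eq_mk fun N => by rw [toFree_concat, toFree_eq_mul hS]

/-- The Hawaiian earring group is generated by the words in the first `N` letters and those in the
remaining letters. -/
theorem apply_retraction_of_tail_le_ker {G : Type w} [Group G] {φ : EarringGroup →* G} {N : ℕ}
    (hφ : tail N ≤ φ.ker) (n : ℕ) :
    ∀ W : EarringWord, (W.positions N).length ≤ n → φ (mk W) = φ (retraction N (mk W)) := by
  induction n using Nat.strong_induction_on with
  | _ n ih =>
  intro W hn
  by_cases hW : ∀ i, N ≤ (W.letter i).1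
  · have hmem : mk W ∈ tail N := ⟨W, hW, rfl⟩
    rw [retraction_eq_one hmem, map_one]
    exact hφ hmem
  push Not at hW
  obtain ⟨i, hi⟩ := hW
  have hS : IsLowerSet {j | j < i} := fun a b hba ha => lt_of_le_of_lt hba ha
  -- The word is cut just before and just after a position `i` carrying a letter of index below `N`.
  -- The middle piece is that position alone, so both outer pieces have fewer such letters.
  let B := W.restrict {j | j < i}ᶜ
  let T : Set B.Carrier := {j : {j // j ∈ ({j | j < i}ᶜ : Set W.Carrier)} | j.1 ≤ i}
  have hT : IsLowerSet T := fun a b hba ha => le_trans (Subtype.coe_le_coe.2 hba) ha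
  have hB : ∀ j : (B.restrict T).Carrier, ((B.restrict T).letter j).1 < N := by
    rintro ⟨⟨j, hj⟩, hj'⟩
    have : j = i := le_antisymm hj' (not_lt.1 hj)
    subst this
    exact hi
  have hpos : 0 < ((B.restrict T).positions N).length := by
    let i' : (B.restrict T).Carrier := ⟨⟨i, lt_irrefl i⟩, le_rfl⟩
    exact List.length_pos_of_mem (mem_positions.2 (hB i'))
  have h₁ := length_positions_eq_add hS N
  have h₂ := length_positions_eq_add hT N
  change (W.positions N).length = _ + (B.positions N).length at h₁
  have hmk : mk W = mk (W.restrict {j | j < i}) * (mk (B.restrict T) * mk (B.restrict Tᶜ)) := by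
    rw [mk_eq_mul hS, ← mk_eq_mul hT]
  rw [hmk, map_mul, map_mul, map_mul, map_mul, map_mul, map_mul, retraction_mk_eq_self hB,
    ih _ (by omega) (W.restrict {j | j < i}) le_rfl, ih _ (by omega) (B.restrict Tᶜ) le_rfl]

/-- This turns n-slenderness into a condition on kernels: each must contain a tail. -/
theorem eq_comp_retraction_iff {G : Type w} [Group G] (φ : EarringGroup →* G) (N : ℕ) :
    φ = φ.comp (retraction N) ↔ tail N ≤ φ.ker := by
  constructor
  · intro h y hy
    rw [MonoidHom.mem_ker, h, MonoidHom.comp_apply, retraction_eq_one hy, map_one]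
  · intro h
    refine MonoidHom.ext fun y => ?_
    obtain ⟨W, rfl⟩ : ∃ W, mk W = y := Quotient.exists_rep y
    exact apply_retraction_of_tail_le_ker h _ W le_rfl

/-- The endomorphism increasing the indices of all letters by `n`. -/
def shiftHom (n : ℕ) : EarringGroup →* EarringGroup :=
  MonoidHom.mk'
    (Quotient.map (shift n) fun _ _ h N => by rw [toFree_shift, toFree_shift, h])
    (by
      rintro ⟨a⟩ ⟨b⟩
      exact Quotient.sound fun N => by simp only [toFree_concat, toFree_shift, map_mul])

theorem shiftHom_mk (n : ℕ) (W : EarringWord) : shiftHom n (mk W) = mk (W.shift n) := rfl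

theorem shiftHom_mem_tail (n : ℕ) (y : EarringGroup) : shiftHom n y ∈ tail n := by
  obtain ⟨W, rfl⟩ : ∃ W, mk W = y := Quotient.exists_rep y
  exact ⟨W.shift n, fun i => Nat.le_add_left n _, rfl⟩

/-- Lowering the indices inverts the shift on deep tails; this gives the filter inequality needed
for restricting test groups. -/
theorem tail_add_le_map_shiftHom (m n : ℕ) : tail (m + n) ≤ (tail m).map (shiftHom n) := by
  rintro _ ⟨W, hW, rfl⟩
  refine ⟨mk (W.unshift n), ⟨W.unshift n, fun i => Nat.le_sub_of_add_le (hW i), rfl⟩, ?_⟩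
  rw [shiftHom_mk]
  exact mk_eq_mk (toFree_shift_unshift fun i => (Nat.le_add_left n m).trans (hW i))

/-- The filter generated by the subgroups `tail N`. -/
def tailFilter : Filter EarringGroup := ⨅ N, 𝓟 (tail N : Set EarringGroup)

theorem mem_tailFilter {B : Set EarringGroup} :
    B ∈ tailFilter ↔ ∃ N, (tail N : Set EarringGroup) ⊆ B := by
  have := (hasBasis_iInf_principal (s := fun N => (tail N : Set EarringGroup))
    (directed_of_isDirected_le fun M N h => tail_antitone h)).mem_iff (t := B)
  simpa [tailFilter] using this

theorem hasInfiniteProducts : HasInfiniteProducts EarringGroup tailFilter := by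
  intro A hA V hV k
  choose N hN using fun l => mem_tailFilter.1 (hV l)
  -- Along a history, `M` dominates `N` and the length and never decreases. Hence all words from
  -- stage `n` on lie beyond the bound for `V (history g n)`, and the nested word has finitely many
  -- letters of each index.
  let M : List EarringGroup → ℕ := fun l =>
    List.rec (N []) (fun g l m => max (N (g :: l)) (max m (l.length + 1))) l
  obtain ⟨g, hg⟩ := exists_sequence_of_history (p := fun l a => a ∈ A ∧ a ∈ tail (M l))
    fun l => hA _ (mem_tailFilter.2 ⟨M l, subset_rfl⟩)
  have hM_succ : ∀ m, M (history g (m + 1)) =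
      max (N (history g (m + 1))) (max (M (history g m)) (m + 1)) := fun m => by
    change max _ (max _ ((history g m).length + 1)) = _
    rw [length_history]
    rfl
  have hM_mono : Monotone fun m => M (history g m) := monotone_nat_of_le_succ fun m => by
    rw [hM_succ]
    exact (le_max_left _ _).trans (le_max_right _ _)
  have hM_le : ∀ m, m ≤ M (history g m) := by
    rintro (_ | m)
    · exact Nat.zero_le _
    · rw [hM_succ]
      exact (le_max_right _ _).trans (le_max_right _ _)
  have hN_le : ∀ m, N (history g m) ≤ M (history g m) := by
    rintro (_ | m)
    · exact le_rfl
    · rw [hM_succ]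
      exact le_max_left _ _
  choose W hW hWg using fun m => (hg m).2
  have hW' : ∀ m i, m ≤ ((W m).letter i).1 := fun m i => (hM_le m).trans (hW m i)
  let κ : ℕ → ℕ := fun n => k (history g (n + 1))
  refine ⟨g, fun n => mk (nested W κ hW' n), fun n => ⟨(hg n).1, hN _ ?_, ?_⟩⟩
  · exact ⟨nested W κ hW' n, NestedPosition.le_letter fun m hm i =>
      (hN_le n).trans ((hM_mono hm).trans (hW m i)), rfl⟩
  · rw [← hWg n]
    -- Powers are represented by actual words, so that the equation can be checked through `toFree`.
    have hpow : ∀ (X : EarringWord) (j : ℕ), ∃ Y : EarringWord, mk Y = mk X ^ j ∧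
        ∀ N, toFree N Y = toFree N X ^ j := by
      intro X j
      induction j with
      | zero => exact ⟨empty, rfl, fun N => toFree_empty N⟩
      | succ j ih =>
        obtain ⟨Y, hY, hY'⟩ := ih
        refine ⟨Y.concat X, ?_, fun N => by rw [toFree_concat, hY', pow_succ]⟩
        rw [pow_succ, ← hY]
        rfl
    obtain ⟨Y, hY, hY'⟩ := hpow (nested W κ hW' (n + 1)) (κ n)
    change _ = _ * _ ^ κ n
    rw [← hY]
    exact mk_eq_mk fun N => by rw [toFree_concat, hY', toFree_nested]

end EarringGroup

/-! ### The earring test class and the main theorem -/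

/-- The Hawaiian earring group with the filter of its tails. -/
inductive EarringTest : (H : Type 1) → [Group H] → Filter H → Prop
  | mk : EarringTest EarringGroup EarringGroup.tailFilter

theorem isTestClass_earringTest : IsTestClass EarringTest where
  hasInfiniteProducts := by
    rintro H _ N ⟨⟩
    exact EarringGroup.hasInfiniteProducts
  restrict := by
    rintro H _ N ⟨⟩ U hU
    obtain ⟨n, hn⟩ := EarringGroup.mem_tailFilter.1 hU
    refine ⟨EarringGroup, inferInstance, EarringGroup.tailFilter, EarringGroup.shiftHom n,
      EarringTest.mk, fun y => hn (EarringGroup.shiftHom_mem_tail n y), fun B hB => ?_⟩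
    obtain ⟨m, hm⟩ := EarringGroup.mem_tailFilter.1 (mem_map.1 hB)
    refine EarringGroup.mem_tailFilter.2 ⟨m + n, fun y hy => ?_⟩
    obtain ⟨z, hz, rfl⟩ := EarringGroup.tail_add_le_map_shiftHom m n hy
    exact hm hz

theorem nSlender_iff {G : Type w} [Group G] : NSlender G ↔ SlenderFor EarringTest G := by
  constructor
  · rintro h H _ N ⟨⟩ φ
    obtain ⟨N, hN⟩ := h φ
    exact EarringGroup.mem_tailFilter.2 ⟨N, (EarringGroup.eq_comp_retraction_iff φ N).1 hN⟩
  · intro h φ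
    obtain ⟨N, hN⟩ := EarringGroup.mem_tailFilter.1 (h EarringGroup _ EarringTest.mk φ)
    exact ⟨N, (EarringGroup.eq_comp_retraction_iff φ N).2 hN⟩

theorem SlenderFor.graphProduct_and_coprodI_and_directSum
    {C : (H : Type x) → [Group H] → Filter H → Prop} (hC : IsTestClass C) {V : Type u}
    {Γ : SimpleGraph V} {G : V → Type w} [∀ v, Group (G v)] (hG : ∀ v, SlenderFor C (G v)) :
    SlenderFor C (GraphProduct Γ G) ∧ SlenderFor C (Monoid.CoprodI G) ∧
      SlenderFor C (directSumSubgroup G) :=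
  ⟨GraphProduct.slenderFor hC hG, SlenderFor.coprodI hC hG, SlenderFor.directSum hC hG⟩

theorem mainTheorem4 {V : Type u} (Γ : SimpleGraph V) (G : V → Type w) [∀ v, Group (G v)] :
    ((∀ v, NSlender (G v)) →
      NSlender (GraphProduct Γ G) ∧
      NSlender (Monoid.CoprodI G) ∧
      NSlender (directSumSubgroup G)) ∧
    ((∀ v, CmSlender.{w, x} (G v)) →
      CmSlender.{max u w, x} (GraphProduct Γ G) ∧
      CmSlender.{max u w, x} (Monoid.CoprodI G) ∧
      CmSlender.{max u w, x} (directSumSubgroup G)) ∧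
    ((∀ v, LcHSlender.{w, x} (G v)) →
      LcHSlender.{max u w, x} (GraphProduct Γ G) ∧
      LcHSlender.{max u w, x} (Monoid.CoprodI G) ∧
      LcHSlender.{max u w, x} (directSumSubgroup G)) := by
  simp only [nSlender_iff, cmSlender_iff, lcHSlender_iff]
  exact ⟨SlenderFor.graphProduct_and_coprodI_and_directSum isTestClass_earringTest,
    SlenderFor.graphProduct_and_coprodI_and_directSum isTestClass_completelyMetrizableTest,
    SlenderFor.graphProduct_and_coprodI_and_directSum isTestClass_locallyCompactTest⟩
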